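/- Let $A$ be a unital separable simple $C^*$-algebra which is infinite dimensional (equivalently, nonelementary, i.e. not isomorphic to a matrix algebra $M_n(\mathbb C)$) and which has tracial topological rank at most one, $TR(A)\le 1$. The latter means: for every $\varepsilon>0$, every finite subset $\mathcal F\subset A$ and every nonzero positive element $a\in\mathcal F$, there are a nonzero projection $p\in A$ and a $C^*$-subalgebra $C\subset A$ with unit $1_C=p$ and $C\cong\bigoplus_{i=1}^k M_{n_i}(C(X_i))$, where each $X_i$ is a finite CW complex of dimension at most one, such that (i) $\|px-xp\|<\varepsilon$ for all $x\in\mathcal F$; (ii) for every $x\in\mathcal F$ there is $c\in C$ with $\|pxp-c\|<\varepsilon$; (iii) $1-p$ is Murray–von Neumann equivalent to a projection in $\overline{aAa}$. Let $U(A)$ be the unitary group of $A$, let $U_0(A)$ be the connected component of the identity in $U(A)$, and let $CU(A)$ be the norm closure of the commutator subgroup of $U(A)$. If $u\in U_0(A)$ and $u^k\in CU(A)$ for some integer $k>0$, then $u\in CU(A)$. In particular, $U_0(A)/CU(A)$ (the image of $U_0(A)$ in the abelian group $U(A)/CU(A)$) is torsion free. -/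

import Mathlib

open Topology

/-- `X` carries the structure of a finite CW complex (all of whose cells have) dimension at most
one. -/
def IsFiniteCWComplexDimLEOne (X : Type) [TopologicalSpace X] : Prop :=
  ∃ _ : CWComplex (Set.univ : Set X),
    RelCWComplex.Finite (Set.univ : Set X) ∧
      ∀ n : ℕ, 1 < n → IsEmpty (RelCWComplex.cell (Set.univ : Set X) n)

/-- A C⋆-subalgebra `C` of `A` (a norm closed, not necessarily unital, star subalgebra) which is
⋆-isomorphic to a finite direct sum `⨁ᵢ M_{nᵢ}(C(Xᵢ))`, where each `Xᵢ` is a finite (Hausdorff)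
CW complex of dimension at most one. -/
def IsMatrixBlockSubalgebraDimLEOne {A : Type*} [CStarAlgebra A]
    (C : NonUnitalStarSubalgebra ℂ A) : Prop :=
  IsClosed (C : Set A) ∧
    ∃ (k : ℕ) (n : Fin k → ℕ) (X : Fin k → Type) (_ : ∀ i, TopologicalSpace (X i)),
      (∀ i, 1 ≤ n i) ∧ (∀ i, T2Space (X i)) ∧ (∀ i, IsFiniteCWComplexDimLEOne (X i)) ∧
        Nonempty (C ≃⋆ₐ[ℂ] ((i : Fin k) → Matrix (Fin (n i)) (Fin (n i)) C(X i, ℂ)))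

/-- Murray–von Neumann equivalence of two projections. -/
def MurrayVonNeumannEquiv {A : Type*} [CStarAlgebra A] (p q : A) : Prop :=
  ∃ v : A, star v * v = p ∧ v * star v = q

/-- `TR(A) ≤ 1`: the (simple) C⋆-algebra `A` has tracial topological rank no more than one. -/
def TracialRankLEOne (A : Type*) [CStarAlgebra A] [PartialOrder A] [StarOrderedRing A] : Prop :=
  ∀ ε : ℝ, 0 < ε → ∀ F : Finset A, ∀ a ∈ F, 0 ≤ a → a ≠ 0 →
    ∃ (p : A) (C : NonUnitalStarSubalgebra ℂ A),
      IsStarProjection p ∧ p ≠ 0 ∧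
      -- `C` is of the form `⨁ᵢ M_{nᵢ}(C(Xᵢ))` and `p` is its unit
      IsMatrixBlockSubalgebraDimLEOne C ∧
      p ∈ C ∧ (∀ c ∈ C, p * c = c ∧ c * p = c) ∧
      (∀ x ∈ F, ‖p * x - x * p‖ < ε) ∧
      (∀ x ∈ F, ∃ c ∈ C, ‖p * x * p - c‖ < ε) ∧
      -- `1 - p` is equivalent to a projection in the closure of `aAa`
      ∃ q : A, IsStarProjection q ∧ q ∈ closure (Set.range fun x : A => a * x * a) ∧
        MurrayVonNeumannEquiv (1 - p) q

/-- A C⋆-algebra is simple if it is nonzero and has no closed two-sided ideals besides `0` and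
itself. -/
def IsSimpleCStarAlgebra (A : Type*) [CStarAlgebra A] : Prop :=
  Nontrivial A ∧ ∀ I : TwoSidedIdeal A, IsClosed (I : Set A) → I = ⊥ ∨ I = ⊤

/-- `U₀(A)`: the connected component of the identity in the unitary group `U(A)`. -/
def U₀ (A : Type*) [CStarAlgebra A] : Subgroup (unitary A) :=
  Subgroup.connectedComponentOfOne (unitary A)

/-- `CU(A)`: the norm closure of the commutator subgroup of the unitary group `U(A)`. -/
def CU (A : Type*) [CStarAlgebra A] : Subgroup (unitary A) :=
  (commutator (unitary A)).topologicalClosure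

instance CU_normal (A : Type*) [CStarAlgebra A] : (CU A).Normal :=
  Subgroup.is_normal_topologicalClosure _

/-! The exponential turns the problem into an additive one. By a Trotter argument `x ↦ [exp(i Re
x)]` is a continuous homomorphism from `A` to the abelian group `U(A)/CU(A)` (`mk_expUnitary_add`).
Its kernel `logCU A` is therefore a closed subgroup, and it contains every additive commutator
(`commutator_mem_logCU`). As `U₀(A)` consists of exponentials modulo `CU(A)`, it suffices that
`exp(ikh) ∈ CU(A)` puts a self-adjoint `h` in the closure of `logCU A`.

Tracial rank supplies a subalgebra `D = {d : pd = dp, pd ∈ C}` approximating any prescribed finite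
set. In it, `exp(ikg) = exp(iT)·v` with `g` near `h`, `T` small and `v` a product of commutators of
unitaries of `D`. Determinants at the points of the blocks of `C` give `k·tr g = tr T + 2πM` with
`M` a continuous integer-valued function. Write `M = kq + r` with `0 ≤ r < k`. The part `2πq` of `tr
g` is the trace of an element with trivial exponential. The rest, at most `n‖T‖ + 2π` in a block of
size `n`, spreads over the diagonal as an element of norm at most `‖T‖ + 2π/n`. Simplicity and
infinite dimension force `n` to be large (`eventually_le_of_starAlgHom`). A block matrix with zero
traces is a sum of commutators, so `pg` is small modulo `logCU A` (`exists_norm_le_of_cornerEval`).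

The complement `1 - p` has many orthogonal equivalent copies, so `(1-p)g` can be averaged over them
and is also small modulo `logCU A` (`exists_norm_le_of_copies`). -/

section TorsionFree

open Filter NormedSpace selfAdjoint Complex
open scoped commutatorElement ComplexStarModule

/-! ### The exponential homomorphism to U/CU and its kernel -/

section Kernel

variable {A : Type*} [CStarAlgebra A]

instance unitaryModCUCommGroup : CommGroup (unitary A ⧸ CU A) where
  mul_comm := by
    have : IsMulCommutative (unitary A ⧸ CU A) :=
      Subgroup.Normal.quotient_commutative_iff_commutator_le.mpr
        (Subgroup.le_topologicalClosure _)
    exact mul_comm'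

lemma isClosed_CU : IsClosed (CU A : Set (unitary A)) :=
  Subgroup.isClosed_topologicalClosure _

lemma norm_unitary_pow_sub_one_le (u : unitary A) (n : ℕ) :
    ‖((u ^ n : unitary A) : A) - 1‖ ≤ n * ‖(u : A) - 1‖ := by
  induction n with
  | zero => simp
  | succ n ih =>
    have : ((u ^ (n + 1) : unitary A) : A) - 1 =
        (((u ^ n : unitary A) : A) - 1) * u + ((u : A) - 1) := by
      push_cast; noncomm_ring
    rw [this]
    refine (norm_add_le _ _).trans ?_
    rw [CStarRing.norm_mul_coe_unitary]
    rw [Nat.cast_succ, add_mul, one_mul]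
    gcongr

lemma expUnitary_nsmul (a : selfAdjoint A) (n : ℕ) :
    expUnitary (n • a) = expUnitary a ^ n := by
  induction n with
  | zero => simp
  | succ n ih =>
    rw [succ_nsmul, pow_succ, Commute.expUnitary_add, ih]
    exact_mod_cast (Commute.refl (a : A)).smul_left n

lemma hasDerivAt_expUnitary_smul (a : selfAdjoint A) :
    HasDerivAt (fun t : ℝ => ((expUnitary (t • a) : unitary A) : A)) (I • (a : A)) 0 := by
  have h := hasDerivAt_exp_smul_const (𝕂 := ℝ) (I • (a : A)) (0 : ℝ)
  rw [zero_smul, NormedSpace.exp_zero, one_mul] at h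
  refine h.congr_of_eventuallyEq (Eventually.of_forall fun t => ?_)
  simp only [expUnitary_coe, val_smul]
  rw [smul_comm]

lemma expUnitary_neg (a : selfAdjoint A) : expUnitary (-a) = (expUnitary a)⁻¹ := by
  rw [eq_inv_iff_mul_eq_one, ← Commute.expUnitary_add]
  · simp
  · exact_mod_cast (Commute.refl (a : A)).neg_left

/-- The triple product is a curve through `1` with derivative `ia + ib - i(a+b) = 0`, so it is `1 +
o(1/n)` at time `1/n`, which survives an `n`-th power. -/
lemma tendsto_trotter_error (a b : selfAdjoint A) :
    Tendsto (fun n : ℕ => (expUnitary ((n : ℝ)⁻¹ • a) * expUnitary ((n : ℝ)⁻¹ • b) *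
      expUnitary ((n : ℝ)⁻¹ • (-(a + b)))) ^ n) atTop (𝓝 1) := by
  have hd : HasDerivAt (fun t : ℝ => ((expUnitary (t • a) * expUnitary (t • b) *
      expUnitary (t • (-(a + b))) : unitary A) : A)) 0 0 := by
    have := ((hasDerivAt_expUnitary_smul a).mul (hasDerivAt_expUnitary_smul b)).mul
      (hasDerivAt_expUnitary_smul (-(a + b)))
    convert! this using 1
    simp
  have hs := hd.tendsto_slope_zero
  simp only [zero_add, zero_smul, expUnitary_zero, mul_one, OneMemClass.coe_one] at hs
  have hn : Tendsto (fun n : ℕ => ((n : ℝ)⁻¹)) atTop (𝓝[≠] 0) := by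
    refine tendsto_nhdsWithin_iff.mpr ⟨tendsto_inv_atTop_nhds_zero_nat, ?_⟩
    filter_upwards [eventually_gt_atTop 0] with n hn
    simp; omega
  have h0 := (hs.comp hn).norm
  simp only [norm_zero] at h0
  rw [tendsto_subtype_rng, tendsto_iff_norm_sub_tendsto_zero]
  refine squeeze_zero (fun _ => norm_nonneg _) (fun n => ?_) h0
  refine (norm_unitary_pow_sub_one_le _ n).trans (le_of_eq ?_)
  simp [norm_smul]

/-- In an abelian quotient the `n`-th power of a product of `n`-th roots is the product of the
originals. So `w` agrees modulo `CU A` with the Trotter error for every `n > 0`; that error tends to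
`1` and `CU A` is closed. -/
lemma mk_expUnitary_add (a b : selfAdjoint A) :
    (expUnitary (a + b) : unitary A ⧸ CU A) = expUnitary a * expUnitary b := by
  have hroot : ∀ (c : selfAdjoint A) (n : ℕ), 0 < n →
      expUnitary ((n : ℝ)⁻¹ • c) ^ n = expUnitary c := by
    intro c n hn
    rw [← expUnitary_nsmul, ← Nat.cast_smul_eq_nsmul ℝ, smul_smul, mul_inv_cancel₀, one_smul]
    positivity
  set w : unitary A := expUnitary a * expUnitary b * expUnitary (-(a + b)) with hw
  have hmem : w ∈ CU A := by
    have ht : Tendsto (fun n : ℕ => w * ((expUnitary ((n : ℝ)⁻¹ • a) *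
        expUnitary ((n : ℝ)⁻¹ • b) * expUnitary ((n : ℝ)⁻¹ • (-(a + b)))) ^ n)⁻¹)
        atTop (𝓝 w) := by
      simpa using tendsto_const_nhds.mul (tendsto_trotter_error a b).inv
    refine isClosed_CU.mem_of_tendsto ht ?_
    filter_upwards [eventually_gt_atTop 0] with n hn
    refine (QuotientGroup.eq_one_iff (N := CU A) _).mp ?_
    rw [QuotientGroup.mk_mul, QuotientGroup.mk_inv, QuotientGroup.mk_pow, mul_inv_eq_one, hw]
    simp only [QuotientGroup.mk_mul, mul_pow]
    simp only [← QuotientGroup.mk_pow, hroot _ n hn]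
  have := (QuotientGroup.eq_one_iff (N := CU A) _).mpr hmem
  rw [hw, expUnitary_neg, QuotientGroup.mk_mul, QuotientGroup.mk_mul, QuotientGroup.mk_inv,
    mul_inv_eq_one] at this
  exact this.symm

/-- The homomorphism `x ↦ exp (i Re x)` from `A` to `U(A) / CU(A)`. -/
noncomputable def expModCU (A : Type*) [CStarAlgebra A] : A →+ Additive (unitary A ⧸ CU A) where
  toFun x := Additive.ofMul (expUnitary (realPart x) : unitary A ⧸ CU A)
  map_zero' := by simp
  map_add' x y := by
    rw [map_add, mk_expUnitary_add, ofMul_mul]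

/-- The set of `x` with `exp (i Re x) ∈ CU(A)`. -/
noncomputable def logCU (A : Type*) [CStarAlgebra A] : AddSubgroup A := (expModCU A).ker

lemma mem_logCU {x : A} : x ∈ logCU A ↔ expUnitary (realPart x) ∈ CU A := by
  rw [← QuotientGroup.eq_one_iff]; exact Iff.rfl

lemma coe_mem_logCU {x : selfAdjoint A} : (x : A) ∈ logCU A ↔ expUnitary x ∈ CU A := by
  rw [mem_logCU, realPart_coe]

lemma isClosed_logCU : IsClosed (logCU A : Set A) := by
  have hc : Continuous fun x : A => expUnitary (realPart x) := by
    refine continuous_expUnitary.comp ?_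
    rw [continuous_induced_rng]
    simp only [Function.comp_def, realPart_apply_coe]
    fun_prop
  convert! isClosed_CU.preimage hc using 1
  ext x
  exact mem_logCU

lemma mem_logCU_of_realPart_eq_zero {x : A} (hx : (realPart x : A) = 0) : x ∈ logCU A := by
  rw [mem_logCU, show realPart x = 0 from Subtype.ext hx, expUnitary_zero]
  exact one_mem _

lemma coe_expUnitary_conj (u : unitary A) (b : selfAdjoint A)
    (c : selfAdjoint A) (hc : (c : A) = u * b * star (u : A)) :
    expUnitary c = u * expUnitary b * u⁻¹ := by
  let +nondep : NormedAlgebra ℚ A := .restrictScalars ℚ ℂ A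
  ext
  have h := exp_units_conj (Unitary.toUnits u) (I • (b : A))
  rw [expUnitary_coe, hc]
  convert! h using 2
  simp [mul_assoc]
  rfl

/-- Conjugation by `u` commutes with the exponential and is invisible in an abelian quotient. -/
lemma conj_sub_mem_logCU (u : unitary A) {b : A} (hb : IsSelfAdjoint b) :
    u * b * star (u : A) - b ∈ logCU A := by
  let c : selfAdjoint A := ⟨u * b * star (u : A), hb.conjugate _⟩
  let b' : selfAdjoint A := ⟨b, hb⟩
  have : expModCU A (c : A) = expModCU A (b' : A) := by
    change Additive.ofMul (expUnitary (realPart (c : A)) : unitary A ⧸ CU A) =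
      Additive.ofMul (expUnitary (realPart (b' : A)) : unitary A ⧸ CU A)
    rw [realPart_coe, realPart_coe, coe_expUnitary_conj u b' c rfl]
    simp
  change expModCU A ((c : A) - b') = 0
  rw [map_sub, this, sub_self]

/-- `i[a,b]` is the derivative at `0` of `exp(ita) b exp(-ita)`, and each difference quotient is a
unitary conjugate of `b/t` minus `b/t`. -/
lemma I_smul_commutator_mem_logCU {a b : A} (ha : IsSelfAdjoint a) (hb : IsSelfAdjoint b) :
    I • (a * b - b * a) ∈ logCU A := by
  let a' : selfAdjoint A := ⟨a, ha⟩
  have h1 := hasDerivAt_expUnitary_smul a'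
  have h2 : HasDerivAt (fun t : ℝ => star ((expUnitary (t • a') : unitary A) : A))
      (star (I • a)) 0 := h1.star
  have hd := (h1.mul_const b).mul h2
  have hs := hd.tendsto_slope_zero
  refine isClosed_logCU.mem_of_tendsto (f := fun t : ℝ => t⁻¹ • (
    (expUnitary (t • a') * b * star ((expUnitary (t • a') : unitary A) : A)) - b))
    (b := 𝓝[≠] 0) ?_ (Eventually.of_forall fun t => ?_)
  · convert! hs using 2
    · simp
    · simp [a', smul_sub, ha.star_eq]
      abel
  · have := conj_sub_mem_logCU (expUnitary (t • a')) ((IsSelfAdjoint.all (t⁻¹ : ℝ)).smul hb)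
    simpa [smul_sub] using this

/-- Expand into real and imaginary parts: the pure terms are skew-adjoint, hence have no real part,
and the mixed terms are `i` times commutators of self-adjoint elements. -/
lemma commutator_mem_logCU (c d : A) : c * d - d * c ∈ logCU A := by
  have skew : ∀ {a b : A}, IsSelfAdjoint a → IsSelfAdjoint b → a * b - b * a ∈ logCU A := by
    intro a b ha hb
    refine mem_logCU_of_realPart_eq_zero ?_
    rw [realPart_apply_coe]
    simp [ha.star_eq, hb.star_eq]
  have h1 := skew (realPart c).2 (realPart d).2
  have h2 := I_smul_commutator_mem_logCU (realPart c).2 (imaginaryPart d).2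
  have h3 := I_smul_commutator_mem_logCU (imaginaryPart c).2 (realPart d).2
  have h4 := skew (imaginaryPart d).2 (imaginaryPart c).2
  have := add_mem (add_mem h1 h2) (add_mem h3 h4)
  convert! this using 1
  have key (x y z w : A) : (x + I • y) * (z + I • w) - (z + I • w) * (x + I • y) =
      x * z - z * x + I • (x * w - w * x) + (I • (y * z - z * y) + (w * y - y * w)) := by
    simp only [add_mul, mul_add, smul_mul_assoc, mul_smul_comm, smul_add, smul_smul, I_mul_I,
      smul_sub, neg_one_smul]
    abel
  rw [← key, realPart_add_I_smul_imaginaryPart, realPart_add_I_smul_imaginaryPart]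

/-- Elements of `U₀(A)` are exponentials modulo `CU(A)`. -/
lemma exists_mk_expUnitary_eq {u : unitary A} (hu : u ∈ U₀ A) :
    ∃ h : selfAdjoint A, (expUnitary h : unitary A ⧸ CU A) = u := by
  have hu' : u ∈ pathComponent (1 : unitary A) := by
    rw [pathComponent_eq_connectedComponent]; exact hu
  obtain ⟨l, rfl⟩ := Unitary.mem_pathComponentOne_iff.mp hu'
  -- The path component of `1` consists of finite products of exponentials; modulo `CU A` the
  -- exponents add up.
  refine ⟨l.sum, ?_⟩
  induction l with
  | nil => simp
  | cons a l ih =>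
    rw [List.sum_cons, mk_expUnitary_add, ih ?_, List.map_cons, List.prod_cons,
      QuotientGroup.mk_mul]
    · exact Unitary.mem_pathComponentOne_iff.mpr ⟨l, rfl⟩
    · change _ ∈ connectedComponent (1 : unitary A)
      rw [← pathComponent_eq_connectedComponent]
      exact Unitary.mem_pathComponentOne_iff.mpr ⟨l, rfl⟩

end Kernel

/-! ### Algebraic consequences of simplicity -/

section Simple

variable {A : Type*} [CStarAlgebra A]

/-- In a simple C⋆-algebra every nonzero element generates the unit algebraically. -/
lemma IsSimpleCStarAlgebra.exists_sum_mul_mul_eq_one (hA : IsSimpleCStarAlgebra A) {a : A}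
    (ha : a ≠ 0) : ∃ (n : ℕ) (r s : Fin n → A), ∑ i, r i * a * s i = 1 := by
  let J : AddSubgroup A := AddSubgroup.closure {x | ∃ r s, x = r * a * s}
  have hleft : ∀ x y : A, y ∈ J → x * y ∈ J := by
    intro x y hy
    refine AddSubgroup.closure_induction ?_ ?_ ?_ ?_ hy
    · rintro _ ⟨r, s, rfl⟩
      exact AddSubgroup.subset_closure ⟨x * r, s, by simp [mul_assoc]⟩
    · simp
    · intro y z _ _ hy hz
      rw [mul_add]; exact add_mem hy hz
    · intro y _ hy
      rw [mul_neg]; exact neg_mem hy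
  have hright : ∀ x y : A, x ∈ J → x * y ∈ J := by
    intro x y hx
    refine AddSubgroup.closure_induction ?_ ?_ ?_ ?_ hx
    · rintro _ ⟨r, s, rfl⟩
      exact AddSubgroup.subset_closure ⟨r, s * y, by simp [mul_assoc]⟩
    · simp
    · intro x z _ _ hx hz
      rw [add_mul]; exact add_mem hx hz
    · intro x _ hx
      rw [neg_mul]; exact neg_mem hx
  have haJ : a ∈ J := AddSubgroup.subset_closure ⟨1, 1, by simp⟩
  let I : TwoSidedIdeal A := TwoSidedIdeal.mk' (J.topologicalClosure : Set A) (zero_mem _)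
    (fun hx hy => add_mem hx hy) (fun hx => neg_mem hx)
    (fun {x y} hy => map_mem_closure (f := fun z => x * z) (by fun_prop) hy
      (fun z hz => hleft x z hz))
    (fun {x y} hx => map_mem_closure (f := fun z => z * y) (by fun_prop) hx
      (fun z hz => hright z y hz))
  have hI : (I : Set A) = J.topologicalClosure := by
    ext x; simp [I]
  have hmem : ∀ x, x ∈ I ↔ x ∈ J.topologicalClosure := fun x => Set.ext_iff.mp hI x
  have hone : (1 : A) ∈ J.topologicalClosure := by
    rcases hA.2 I (hI ▸ J.isClosed_topologicalClosure) with h | h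
    · have := (hmem a).mpr (J.le_topologicalClosure haJ)
      rw [h, TwoSidedIdeal.mem_bot] at this
      exact absurd this ha
    · rw [← hmem, h]; trivial
  -- An element of the algebraic ideal at distance less than `1` from the unit is invertible, so no
  -- closure is needed.
  obtain ⟨j, hj, hd⟩ := Metric.mem_closure_iff.mp hone 1 one_pos
  rw [dist_eq_norm] at hd
  have hu : IsUnit j := by simpa using (Units.oneSub (1 - j) hd).isUnit
  have h1 : (1 : A) ∈ J := by
    have := hright j (↑(hu.unit⁻¹) : A) hj
    rwa [hu.mul_val_inv] at this
  refine AddSubgroup.closure_induction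
    (p := fun x _ => ∃ (n : ℕ) (r s : Fin n → A), ∑ i, r i * a * s i = x) ?_ ?_ ?_ ?_ h1
  · rintro _ ⟨r, s, rfl⟩
    exact ⟨1, fun _ => r, fun _ => s, by simp⟩
  · exact ⟨0, 0, 0, by simp⟩
  · rintro x y _ _ ⟨n, r, s, rfl⟩ ⟨m, r', s', rfl⟩
    exact ⟨n + m, Fin.append r r', Fin.append s s', by simp [Fin.sum_univ_add]⟩
  · rintro x _ ⟨n, r, s, rfl⟩
    exact ⟨n, -r, s, by simp⟩

lemma IsSimpleCStarAlgebra.exists_mul_mul_ne_zero (hA : IsSimpleCStarAlgebra A) {a b : A}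
    (ha : a ≠ 0) (hb : b ≠ 0) : ∃ y, a * y * b ≠ 0 := by
  by_contra! h
  obtain ⟨n, r, s, hs⟩ := hA.exists_sum_mul_mul_eq_one hb
  apply ha
  calc a = a * ∑ i, r i * b * s i := by rw [hs, mul_one]
    _ = ∑ i, (a * r i * b) * s i := by simp [Finset.mul_sum, mul_assoc]
    _ = 0 := by simp [h]

end Simple

/-! ### Orthogonal families in infinite dimension -/

section Orthogonal

variable {A : Type*} [CStarAlgebra A]

/-- There are `m` nonzero, pairwise orthogonal self-adjoint elements in `A`. -/
def HasOrthogonal (A : Type*) [CStarAlgebra A] (m : ℕ) : Prop :=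
  ∃ b : Fin m → A, (∀ i, IsSelfAdjoint (b i) ∧ b i ≠ 0) ∧ ∀ i j, i ≠ j → b i * b j = 0

lemma HasOrthogonal.of_split {m : ℕ} {b : Fin m → A}
    (hb : ∀ i, IsSelfAdjoint (b i) ∧ b i ≠ 0) (hbb : ∀ i j, i ≠ j → b i * b j = 0) (i : Fin m)
    {x y : A} (hx : IsSelfAdjoint x) (hy : IsSelfAdjoint y) (hx0 : x ≠ 0) (hy0 : y ≠ 0)
    (hxy : x * y = 0) (hxb : ∀ j, j ≠ i → x * b j = 0) (hyb : ∀ j, j ≠ i → y * b j = 0) :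
    HasOrthogonal A (m + 1) := by
  have comm0 : ∀ {u v : A}, IsSelfAdjoint u → IsSelfAdjoint v → u * v = 0 → v * u = 0 := by
    intro u v hu hv h
    have := congrArg star h
    simpa [hu.star_eq, hv.star_eq] using this
  refine ⟨Fin.cons x (fun j => if j = i then y else b j), ?_, ?_⟩
  · intro j
    refine Fin.cases ⟨hx, hx0⟩ (fun j => ?_) j
    rw [Fin.cons_succ]
    split_ifs
    exacts [⟨hy, hy0⟩, hb j]
  · intro j k
    refine Fin.cases ?_ (fun j => ?_) j <;> refine Fin.cases ?_ (fun k => ?_) k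
    · simp
    · intro _
      rw [Fin.cons_zero, Fin.cons_succ]
      split_ifs with h
      exacts [hxy, hxb k h]
    · intro _
      rw [Fin.cons_zero, Fin.cons_succ]
      split_ifs with h
      exacts [comm0 hx hy hxy, comm0 hx (hb j).1 (hxb j h)]
    · intro hjk
      have hjk' : j ≠ k := fun h => hjk (h ▸ rfl)
      rw [Fin.cons_succ, Fin.cons_succ]
      split_ifs with h h' h'
      · exact absurd (h.trans h'.symm) hjk'
      · exact hyb k h'
      · exact comm0 hy (hb j).1 (hyb j h)
      · exact hbb j k hjk'

/-- If an orthogonal family is of maximal cardinality, then elements orthogonal to all but one of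
its members have at most one nonzero spectral value. -/
lemma exists_mul_self_eq_smul {m : ℕ} (hm : ¬ HasOrthogonal A (m + 1)) {b : Fin m → A}
    (hb : ∀ i, IsSelfAdjoint (b i) ∧ b i ≠ 0) (hbb : ∀ i j, i ≠ j → b i * b j = 0) (i : Fin m)
    {z : A} (hz : IsSelfAdjoint z) (hzb : ∀ j, j ≠ i → z * b j = 0) :
    ∃ r : ℝ, z * z = r • z := by
  have key : ∀ s ∈ spectrum ℝ z, ∀ t ∈ spectrum ℝ z, s ≠ 0 → t ≠ 0 → s = t := by
    intro s hs t ht hs0 ht0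
    by_contra hst
    apply hm
    set δ := |s - t| / 2 with hδ
    have hδ0 : 0 < δ := by have := abs_pos.mpr (sub_ne_zero.mpr hst); positivity
    -- Hat functions at two nonzero spectral values, disjointly supported by the choice of `δ`. The
    -- extra factor `r` below makes the resulting elements multiples of `z`, hence orthogonal to the
    -- other `b j`.
    let f : ℝ → ℝ → ℝ := fun s r => max 0 (δ - |r - s|)
    have hf : ∀ s, Continuous (f s) := fun s => by fun_prop
    have hmul : ∀ s, cfc (fun r => f s r * r) z = cfc (f s) z * z := by
      intro s
      rw [cfc_mul (f s) (fun r => r) z (hf s).continuousOn, cfc_id' ℝ z]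
    have hne : ∀ s ∈ spectrum ℝ z, s ≠ 0 → cfc (fun r => f s r * r) z ≠ 0 := by
      intro s hs hs0 h
      have h1 : spectrum ℝ (cfc (fun r => f s r * r) z) = (fun r => f s r * r) '' spectrum ℝ z :=
        cfc_map_spectrum (R := ℝ) (fun r => f s r * r) z hz
          ((hf s).mul continuous_id).continuousOn
      have h2 : f s s * s ∈ spectrum ℝ (cfc (fun r => f s r * r) z) := h1 ▸ ⟨s, hs, rfl⟩
      have h3 : Nontrivial A := ⟨⟨b i, 0, (hb i).2⟩⟩
      rw [h, spectrum.zero_eq] at h2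
      simp [f, hs0, hδ0.le, hδ0.ne'] at h2
    refine HasOrthogonal.of_split hb hbb i (cfc_predicate (fun r => f s r * r) z)
      (cfc_predicate (fun r => f t r * r) z) (hne s hs hs0) (hne t ht ht0) ?_ ?_ ?_
    · rw [← cfc_mul (fun r => f s r * r) (fun r => f t r * r) z ((hf s).mul continuous_id).continuousOn
        ((hf t).mul continuous_id).continuousOn]
      convert! cfc_const_zero ℝ z using 2
      ext r
      have : f s r * f t r = 0 := by
        by_contra hne
        have h1 : 0 < δ - |r - s| := by
          by_contra h
          exact hne (by simp [f, max_eq_left (not_lt.mp h)])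
        have h2 : 0 < δ - |r - t| := by
          by_contra h
          exact hne (by simp [f, max_eq_left (not_lt.mp h)])
        have := abs_sub_le s r t
        rw [abs_sub_comm s r] at this
        linarith
      calc f s r * r * (f t r * r) = (f s r * f t r) * (r * r) := by ring
        _ = 0 := by rw [this, zero_mul]
    · intro j hj; rw [hmul, mul_assoc, hzb j hj, mul_zero]
    · intro j hj; rw [hmul, mul_assoc, hzb j hj, mul_zero]
  obtain ⟨r, hr⟩ : ∃ r : ℝ, ∀ s ∈ spectrum ℝ z, s * s = r * s := by
    by_cases h : ∃ s ∈ spectrum ℝ z, s ≠ 0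
    · obtain ⟨r, hr, hr0⟩ := h
      refine ⟨r, fun s hs => ?_⟩
      by_cases hs0 : s = 0
      · simp [hs0]
      · rw [key s hs r hr hs0 hr0]
    · push Not at h
      exact ⟨0, fun s hs => by simp [h s hs]⟩
  refine ⟨r, ?_⟩
  have h1 : cfc (fun s : ℝ => s * s) z = z * z := by
    rw [cfc_mul (fun s : ℝ => s) (fun s => s) z, cfc_id' ℝ z]
  have h2 : cfc (fun s : ℝ => r * s) z = r • z := by
    rw [cfc_const_mul r (fun s => s) z, cfc_id' ℝ z]
  rw [← h1, ← h2]
  exact cfc_congr hr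

/-- An infinite dimensional C⋆-algebra contains arbitrarily many nonzero, pairwise orthogonal
self-adjoint elements. -/
lemma hasOrthogonal_of_not_finiteDimensional (hA : ¬ FiniteDimensional ℂ A) (m : ℕ) :
    HasOrthogonal A m := by
  by_contra hcon
  apply hA
  have hnt : Nontrivial A := by
    by_contra h
    rw [not_nontrivial_iff_subsingleton] at h
    exact hA inferInstance
  -- A family of maximal size rescales to minimal projections `e i` with sum `1`; then each `e i A e
  -- j` is at most one-dimensional and `A` has dimension at most `m²`.
  obtain ⟨m, hm, hm1⟩ : ∃ m, HasOrthogonal A m ∧ ¬ HasOrthogonal A (m + 1) := by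
    by_contra! h
    refine hcon (Nat.rec ?_ h m)
    exact ⟨0, fun i => i.elim0, fun i => i.elim0⟩
  clear hcon
  obtain ⟨b, hb, hbb⟩ := hm
  have hproj : ∀ i, ∃ e : A, (∃ r : ℝ, r ≠ 0 ∧ e = r • b i) ∧ e * e = e := by
    intro i
    obtain ⟨r, hr⟩ := exists_mul_self_eq_smul hm1 hb hbb i (hb i).1
      (fun j hj => hbb i j hj.symm)
    have hr0 : r ≠ 0 := by
      rintro rfl
      apply (hb i).2
      have h0 : star (b i) * b i = 0 := by rw [(hb i).1.star_eq, hr, zero_smul]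
      exact CStarRing.star_mul_self_eq_zero_iff _ |>.mp h0
    refine ⟨r⁻¹ • b i, ⟨r⁻¹, inv_ne_zero hr0, rfl⟩, ?_⟩
    rw [smul_mul_smul_comm, hr, smul_smul]
    congr 1
    field_simp
  choose e he hee using hproj
  have hesa : ∀ i, IsSelfAdjoint (e i) := by
    intro i
    obtain ⟨r, -, hr⟩ := he i
    rw [hr]
    exact (IsSelfAdjoint.all r).smul (hb i).1
  have he0 : ∀ i, e i ≠ 0 := by
    intro i
    obtain ⟨r, hr0, hr⟩ := he i
    rw [hr]
    exact smul_ne_zero hr0 (hb i).2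
  have heo : ∀ i j, i ≠ j → e i * e j = 0 := by
    intro i j hij
    obtain ⟨r, -, hr⟩ := he i
    obtain ⟨s, -, hs⟩ := he j
    rw [hr, hs, smul_mul_smul_comm, hbb i j hij, smul_zero]
  have hsplit := exists_mul_self_eq_smul hm1 (fun i => ⟨hesa i, he0 i⟩) heo
  have hsum : ∑ i, e i = 1 := by
    by_contra hne
    apply hm1
    have hc : IsSelfAdjoint (1 - ∑ i, e i) :=
      (IsSelfAdjoint.one A).sub (isSelfAdjoint_sum _ fun i _ => hesa i)
    have hce : ∀ j, (1 - ∑ i, e i) * e j = 0 := by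
      intro j
      rw [sub_mul, one_mul, Finset.sum_mul, Finset.sum_eq_single j
        (fun i _ hij => heo i j hij) (by simp), hee, sub_self]
    have hec : ∀ j, e j * (1 - ∑ i, e i) = 0 := by
      intro j
      have := congrArg star (hce j)
      rwa [star_mul, hc.star_eq, (hesa j).star_eq, star_zero] at this
    refine ⟨Fin.cons (1 - ∑ i, e i) e, ?_, ?_⟩
    · intro j
      refine Fin.cases ⟨hc, sub_ne_zero.mpr (Ne.symm hne)⟩ (fun j => ?_) j
      exact ⟨hesa j, he0 j⟩
    · intro j k
      refine Fin.cases ?_ (fun j => ?_) j <;> refine Fin.cases ?_ (fun k => ?_) k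
      · simp
      · intro _; exact hce k
      · intro _; exact hec j
      · intro hjk; exact heo j k (fun h => hjk (h ▸ rfl))
  -- A nonzero `e i * y * e i` is a multiple of a projection below `e i`; were that projection
  -- proper, it would split `e i` and enlarge the family.
  have hmin : ∀ i y, IsSelfAdjoint y → ∃ r : ℝ, e i * y * e i = r • e i := by
    intro i y hy
    set z := e i * y * e i with hz
    have hzsa : IsSelfAdjoint z := by
      have := hy.conjugate (e i)
      rwa [(hesa i).star_eq] at this
    have hze : z * e i = z := by rw [hz, mul_assoc, hee]
    have hzb : ∀ j, j ≠ i → z * e j = 0 := by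
      intro j hj
      rw [hz, mul_assoc, heo i j hj.symm, mul_zero]
    obtain ⟨r, hr⟩ := hsplit i hzsa hzb
    by_cases hz0 : z = 0
    · exact ⟨0, by rw [hz0, zero_smul]⟩
    have hr0 : r ≠ 0 := by
      rintro rfl
      apply hz0
      have h0 : star z * z = 0 := by rw [hzsa.star_eq, hr, zero_smul]
      exact CStarRing.star_mul_self_eq_zero_iff _ |>.mp h0
    have hqq : (r⁻¹ • z) * (r⁻¹ • z) = r⁻¹ • z := by
      rw [smul_mul_smul_comm, hr, smul_smul]
      congr 1
      field_simp
    have hqe : (r⁻¹ • z) * e i = r⁻¹ • z := by rw [smul_mul_assoc, hze]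
    have hqsa : IsSelfAdjoint (r⁻¹ • z) := (IsSelfAdjoint.all r⁻¹).smul hzsa
    refine ⟨r, ?_⟩
    by_contra hne
    refine hm1 (HasOrthogonal.of_split (fun i => ⟨hesa i, he0 i⟩) heo i hqsa
      ((hesa i).sub hqsa) (smul_ne_zero (inv_ne_zero hr0) hz0) ?_ ?_ ?_ ?_)
    · intro h
      rw [sub_eq_zero] at h
      apply hne
      rw [h, smul_smul, mul_inv_cancel₀ hr0, one_smul]
    · rw [mul_sub, hqe, hqq, sub_self]
    · intro j hj
      rw [smul_mul_assoc, hzb j hj, smul_zero]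
    · intro j hj
      rw [sub_mul, heo i j hj.symm, smul_mul_assoc, hzb j hj, smul_zero, sub_zero]
  have hcorner : ∀ i y, ∃ c : ℂ, e i * y * e i = c • e i := by
    intro i y
    obtain ⟨r, hr⟩ := hmin i _ (realPart y).2
    obtain ⟨s, hs⟩ := hmin i _ (imaginaryPart y).2
    refine ⟨r + I * s, ?_⟩
    conv_lhs => rw [← realPart_add_I_smul_imaginaryPart y]
    rw [mul_add, add_mul, hr, mul_smul_comm, smul_mul_assoc, hs, add_smul, mul_smul]
    simp
  -- For a nonzero `x` in `e i A e j`, `x x*` is a nonzero multiple `c` of `e i` and `x* (e i y e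
  -- j)` a multiple of `e j`, so multiplying by `c⁻¹ x x*` exhibits `e i y e j` as a multiple of
  -- `x`.
  have hrank : ∀ i j, ∃ x : A, ∀ y, ∃ c : ℂ, e i * y * e j = c • x := by
    intro i j
    by_cases h : ∀ y, e i * y * e j = 0
    · exact ⟨0, fun y => ⟨0, by simp [h]⟩⟩
    push Not at h
    obtain ⟨y₀, hy₀⟩ := h
    set x := e i * y₀ * e j with hx
    obtain ⟨c, hc⟩ := hcorner i (y₀ * e j * star y₀)
    have hxx : x * star x = c • e i := by
      rw [← hc, hx]
      simp only [star_mul, (hesa i).star_eq, (hesa j).star_eq]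
      calc e i * y₀ * e j * (e j * (star y₀ * e i))
          = e i * y₀ * (e j * e j) * star y₀ * e i := by simp only [mul_assoc]
        _ = _ := by rw [hee]; simp only [mul_assoc]
    have hc0 : c ≠ 0 := by
      rintro rfl
      rw [zero_smul, CStarRing.mul_star_self_eq_zero_iff] at hxx
      exact hy₀ hxx
    refine ⟨x, fun y => ?_⟩
    obtain ⟨d, hd⟩ := hcorner j (star y₀ * e i * y)
    have hxy : star x * (e i * y * e j) = d • e j := by
      rw [← hd, hx]
      simp only [star_mul, (hesa i).star_eq, (hesa j).star_eq]
      calc e j * (star y₀ * e i) * (e i * y * e j)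
          = e j * star y₀ * (e i * e i) * y * e j := by simp only [mul_assoc]
        _ = _ := by rw [hee]; simp only [mul_assoc]
    have hxe : x * e j = x := by rw [hx, mul_assoc, hee]
    refine ⟨c⁻¹ * d, ?_⟩
    calc e i * y * e j = c⁻¹ • ((c • e i) * (e i * y * e j)) := by
          rw [smul_mul_assoc, smul_smul, inv_mul_cancel₀ hc0, one_smul, ← mul_assoc, ← mul_assoc,
            hee]
      _ = c⁻¹ • (x * (star x * (e i * y * e j))) := by rw [← hxx, mul_assoc]
      _ = (c⁻¹ * d) • x := by rw [hxy, mul_smul_comm, hxe, smul_smul]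
  choose x hx using hrank
  refine Module.finite_def.mpr ?_
  have htop : (⊤ : Submodule ℂ A) = Submodule.span ℂ (Set.range fun p : Fin m × Fin m =>
      x p.1 p.2) := by
    refine le_antisymm (fun y _ => ?_) le_top
    have hy : y = ∑ i, ∑ j, e i * y * e j := by
      simp_rw [← Finset.mul_sum, ← Finset.sum_mul, hsum, one_mul, mul_one]
    rw [hy]
    refine Submodule.sum_mem _ fun i _ => Submodule.sum_mem _ fun j _ => ?_
    obtain ⟨c, hc⟩ := hx i j y
    rw [hc]
    exact Submodule.smul_mem _ _ (Submodule.subset_span ⟨(i, j), rfl⟩)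
  rw [htop]
  exact Submodule.fg_span (Set.finite_range _)

end Orthogonal

/-! ### Equivalent orthogonal copies of one element -/

section Copies

variable {A : Type*} [CStarAlgebra A] [PartialOrder A] [StarOrderedRing A]

/-- In an infinite dimensional simple C⋆-algebra there are `m` orthogonal equivalent copies of some
nonzero positive element `b`, which acts as a unit on some nonzero positive `e`. -/
lemma exists_orthogonal_copies (hA : IsSimpleCStarAlgebra A) (hinf : ¬ FiniteDimensional ℂ A)
    (m : ℕ) : ∃ (x : Fin m → A) (b e : A), (∀ j, star (x j) * x j = b) ∧
      (∀ j k, j ≠ k → star (x j) * x k = 0) ∧ 0 ≤ e ∧ e ≠ 0 ∧ b * e = e := by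
  have hnt := hA.1
  obtain ⟨c, hc, hcc⟩ := hasOrthogonal_of_not_finiteDimensional hinf m
  -- The factorization `x j = c j * y` yields orthogonality of the copies. The element `e` on which
  -- `b` acts as a unit leaves room to shrink `b` when the next index is added.
  suffices h : ∀ S : Finset (Fin m), ∃ (x : Fin m → A) (b e : A), IsSelfAdjoint b ∧
      (∀ j ∈ S, star (x j) * x j = b ∧ ∃ y, x j = c j * y) ∧ 0 ≤ e ∧ e ≠ 0 ∧ b * e = e by
    obtain ⟨x, b, e, -, h1, h2⟩ := h Finset.univ
    refine ⟨x, b, e, fun j => (h1 j (Finset.mem_univ _)).1, fun j k hjk => ?_, h2⟩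
    obtain ⟨y, hy⟩ := (h1 j (Finset.mem_univ _)).2
    obtain ⟨z, hz⟩ := (h1 k (Finset.mem_univ _)).2
    rw [hy, hz, star_mul, (hc j).1.star_eq, mul_assoc, ← mul_assoc (c j), hcc j k hjk]
    simp
  intro S
  induction S using Finset.induction_on with
  | empty => exact ⟨0, 1, 1, IsSelfAdjoint.one A, by simp, zero_le_one, one_ne_zero, mul_one 1⟩
  | insert i S hi ih =>
    obtain ⟨x, b, e, hb, hx, he, he0, hbe⟩ := ih
    obtain ⟨y, hy⟩ := hA.exists_mul_mul_ne_zero (hc i).2 he0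
    set w := c i * y * e with hw
    set d := star w * w with hd
    have hd0 : 0 ≤ d := star_mul_self_nonneg w
    have hdsa : IsSelfAdjoint d := hd0.isSelfAdjoint
    have hbd : b * d = d := by
      rw [hd, hw, star_mul, he.isSelfAdjoint.star_eq]
      simp only [← mul_assoc]
      rw [hbe]
    have hdne : d ≠ 0 := by rwa [hd, Ne, CStarRing.star_mul_self_eq_zero_iff]
    set ρ := ‖d‖ with hρ
    have hρ0 : 0 < ρ := norm_pos_iff.mpr hdne
    -- The new common value is `g(d)`: `g` vanishes up to `ρ/4` and is `1` from `ρ/2` on, while `g'`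
    -- lives beyond `ρ/2` and is nonzero at `ρ`. The functions `f` and `k` are chosen so that `f t f
    -- = g` and `(t k)² = g`; the `max` avoids division by zero where `g` vanishes anyway.
    let g : ℝ → ℝ := fun t => min 1 (max 0 (4 * t / ρ - 1))
    let g' : ℝ → ℝ := fun t => max 0 (2 * t / ρ - 1)
    let f : ℝ → ℝ := fun t => √(g t / max t (ρ / 4))
    let k : ℝ → ℝ := fun t => √(g t) / max t (ρ / 4)
    have hmax : ∀ t, 0 < max t (ρ / 4) := fun t => lt_max_of_lt_right (by positivity)
    have hg : Continuous g := by fun_prop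
    have hg' : Continuous g' := by fun_prop
    have hf : Continuous f := (hg.div (by fun_prop) fun t => (hmax t).ne').sqrt
    have hk : Continuous k := hg.sqrt.div (by fun_prop) fun t => (hmax t).ne'
    have hg0 : ∀ t, 0 ≤ g t := fun t => le_min zero_le_one (le_max_left _ _)
    have hgz : ∀ t, t ≤ ρ / 4 → g t = 0 := by
      intro t ht
      have : 4 * t / ρ - 1 ≤ 0 := by
        rw [sub_nonpos, div_le_one hρ0]; linarith
      simp [g, max_eq_left this]
    have hff : ∀ t, f t * t * f t = g t := by
      intro t
      rcases le_or_gt t (ρ / 4) with ht | ht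
      · simp [f, hgz t ht]
      · have h1 : max t (ρ / 4) = t := max_eq_left ht.le
        have ht0 : 0 < t := lt_trans (by positivity) ht
        calc f t * t * f t = √(g t / t) * √(g t / t) * t := by simp only [f, h1]; ring
          _ = g t := by rw [Real.mul_self_sqrt (div_nonneg (hg0 t) ht0.le)]; field_simp
    have hkk : ∀ t, (t * k t) * (t * k t) = g t := by
      intro t
      rcases le_or_gt t (ρ / 4) with ht | ht
      · simp [k, hgz t ht]
      · have h1 : max t (ρ / 4) = t := max_eq_left ht.le
        have ht0 : 0 < t := lt_trans (by positivity) ht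
        have : t * k t = √(g t) := by simp only [k, h1]; field_simp
        rw [this, Real.mul_self_sqrt (hg0 t)]
    have hgg : ∀ t, g t * g' t = g' t := by
      intro t
      rcases le_or_gt t (ρ / 2) with ht | ht
      · have : 2 * t / ρ - 1 ≤ 0 := by
          rw [sub_nonpos, div_le_one hρ0]; linarith
        simp [g', max_eq_left this]
      · have h1 : 1 ≤ 4 * t / ρ - 1 := by
          rw [le_sub_iff_add_le, le_div_iff₀ hρ0]; linarith
        have : g t = 1 := min_eq_left (h1.trans (le_max_right _ _))
        rw [this, one_mul]
    set s := d * cfc k d with hs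
    have hscfc : s = cfc (fun t => t * k t) d := by
      rw [cfc_mul (fun t => t) k d continuousOn_id hk.continuousOn, cfc_id' ℝ d]
    have hssa : IsSelfAdjoint s := by rw [hscfc]; exact cfc_predicate _ d
    have hss : s * s = cfc g d := by
      rw [hscfc, ← cfc_mul (fun t => t * k t) (fun t => t * k t) d
        (continuous_id.mul hk).continuousOn (continuous_id.mul hk).continuousOn]
      exact cfc_congr fun t _ => hkk t
    have hbs : b * s = s := by rw [hs, ← mul_assoc, hbd]
    refine ⟨fun j => if j = i then w * cfc f d else x j * s, cfc g d, cfc g' d,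
      cfc_predicate g d, ?_, ?_, ?_, ?_⟩
    · intro j hj
      by_cases hji : j = i
      · subst hji
        simp only [if_true]
        refine ⟨?_, y * e * cfc f d, by rw [hw]; simp only [mul_assoc]⟩
        have hfsa : IsSelfAdjoint (cfc f d) := cfc_predicate f d
        rw [star_mul, hfsa.star_eq]
        calc cfc f d * star w * (w * cfc f d) = cfc f d * d * cfc f d := by
              rw [hd]; simp only [mul_assoc]
          _ = cfc (fun t => f t * t * f t) d := by
              rw [cfc_mul (fun t => f t * t) f d (hf.mul continuous_id).continuousOn
                hf.continuousOn, cfc_mul f (fun t => t) d hf.continuousOn continuousOn_id,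
                cfc_id' ℝ d]
          _ = cfc g d := cfc_congr fun t _ => hff t
      · simp only [if_neg hji]
        obtain ⟨h1, z, hz⟩ := hx j (Finset.mem_of_mem_insert_of_ne hj hji)
        refine ⟨?_, z * s, by rw [hz, mul_assoc]⟩
        calc star (x j * s) * (x j * s) = s * ((star (x j) * x j) * s) := by
              rw [star_mul, hssa.star_eq]; simp only [mul_assoc]
          _ = cfc g d := by rw [h1, hbs, hss]
    · exact cfc_nonneg fun t _ => le_max_left _ _
    · intro h
      have h1 : spectrum ℝ (cfc g' d) = g' '' spectrum ℝ d :=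
        cfc_map_spectrum (R := ℝ) g' d hdsa hg'.continuousOn
      have h2 : g' ρ ∈ spectrum ℝ (cfc g' d) :=
        h1 ▸ ⟨ρ, CStarAlgebra.norm_mem_spectrum_of_nonneg hd0, rfl⟩
      rw [h, spectrum.zero_eq] at h2
      simp [g', hρ0.ne'] at h2
      norm_num at h2
    · rw [← cfc_mul g g' d hg.continuousOn hg'.continuousOn]
      exact cfc_congr fun t _ => hgg t

end Copies

/-! ### Passing to approximating subalgebras -/

section Approximation

variable {A : Type*} [CStarAlgebra A]

lemma abs_inv_sqrt_sub_one_le {t η : ℝ} (h : |t - 1| ≤ η) (hη : η ≤ 1 / 2) :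
    |(√t)⁻¹ - 1| ≤ 2 * η := by
  have ht := abs_le.mp h
  have ht2 : 1 / 2 ≤ t := by linarith
  have h0 : 0 ≤ t := by linarith
  have hs : 1 / 2 ≤ √t := by
    apply Real.le_sqrt_of_sq_le; linarith
  have hs0 : 0 < √t := by linarith
  have hsq : √t * √t = t := Real.mul_self_sqrt h0
  have heq : (√t)⁻¹ - 1 = (1 - t) / (√t * (1 + √t)) := by
    rw [eq_div_iff (by positivity)]
    field_simp
    nlinarith
  rw [heq, abs_div, abs_of_pos (by positivity : 0 < √t * (1 + √t)), abs_sub_comm,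
    div_le_iff₀ (by positivity)]
  have : (1 : ℝ) / 2 ≤ √t * (1 + √t) := by nlinarith
  have hη0 : 0 ≤ η := (abs_nonneg _).trans h
  nlinarith

/-- An almost unitary element is close to a unitary. -/
lemma exists_unitary_norm_sub_le {d : A} {η : ℝ} (hη : η ≤ 1 / 2)
    (h1 : ‖star d * d - 1‖ ≤ η) (h2 : ‖d * star d - 1‖ ≤ η) :
    ∃ v ∈ unitary A, ‖v - d‖ ≤ ‖d‖ * (2 * η) := by
  have hη0 : 0 ≤ η := (norm_nonneg _).trans h1
  set c := star d * d with hc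
  have hcsa : IsSelfAdjoint c := IsSelfAdjoint.star_mul_self d
  have hspec : ∀ t ∈ spectrum ℝ c, |t - 1| ≤ η := by
    intro t ht
    have h : t - 1 ∈ spectrum ℝ (c - algebraMap ℝ A 1) := by
      rw [← spectrum.sub_singleton_eq]
      exact ⟨t, ht, 1, rfl, rfl⟩
    rw [map_one] at h
    have hnt : Nontrivial A := by
      by_contra hn
      rw [not_nontrivial_iff_subsingleton] at hn
      simp [spectrum.of_subsingleton] at h
    exact (spectrum.norm_le_norm_of_mem h).trans h1
  have hpos : ∀ t ∈ spectrum ℝ c, 0 < t := by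
    intro t ht
    have := (abs_le.mp (hspec t ht)).1
    linarith
  let f : ℝ → ℝ := fun t => (√t)⁻¹
  have hf : ContinuousOn f (spectrum ℝ c) :=
    Real.continuous_sqrt.continuousOn.inv₀ fun t ht => (Real.sqrt_pos.mpr (hpos t ht)).ne'
  have hfid : ContinuousOn (fun t => f t * t) (spectrum ℝ c) := hf.mul continuousOn_id
  set s := cfc f c with hs
  have hssa : IsSelfAdjoint s := cfc_predicate f c
  have hscs : s * c * s = 1 := by
    have h : cfc (fun t => f t * t * f t) c = 1 := by
      rw [← cfc_const_one ℝ c]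
      refine cfc_congr fun t ht => ?_
      have ht0 := hpos t ht
      have hs0 := Real.sqrt_pos.mpr ht0
      have : √t * √t = t := Real.mul_self_sqrt ht0.le
      simp only [f]
      field_simp
      rw [sq, this]
    rw [← h, cfc_mul (fun t => f t * t) f c hfid hf, cfc_mul f (fun t => t) c hf continuousOn_id,
      cfc_id' ℝ c]
  have hinv : s * (c * s) = 1 := by rw [← mul_assoc, hscs]
  -- A right inverse of `d` makes the isometry `d * s` right invertible, hence unitary.
  obtain ⟨r, hr⟩ : ∃ r, d * r = 1 := by
    have hu : IsUnit (d * star d) := by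
      have : ‖1 - d * star d‖ < 1 := by rw [norm_sub_rev]; linarith
      simpa using (Units.oneSub (1 - d * star d) this).isUnit
    exact ⟨star d * ↑(hu.unit⁻¹), by rw [← mul_assoc, hu.mul_val_inv]⟩
  have hvv : star (d * s) * (d * s) = 1 := by
    rw [star_mul, hssa.star_eq, ← hscs, hc]
    simp only [mul_assoc]
  have hright : (d * s) * ((c * s) * r) = 1 := by
    calc (d * s) * ((c * s) * r) = d * (s * (c * s)) * r := by simp only [mul_assoc]
      _ = 1 := by rw [hinv, mul_one, hr]
  refine ⟨d * s, ⟨hvv, ?_⟩, ?_⟩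
  · rwa [left_inv_eq_right_inv hvv hright]
  · have : d * s - d = d * (s - 1) := by rw [mul_sub, mul_one]
    rw [this]
    refine (norm_mul_le _ _).trans (mul_le_mul_of_nonneg_left ?_ (norm_nonneg _))
    have hs1 : s - 1 = cfc (fun t => f t - 1) c := by
      rw [cfc_sub f (fun _ => 1) c hf, cfc_const_one ℝ c]
    rw [hs1]
    exact norm_cfc_le (by positivity) fun t ht => abs_inv_sqrt_sub_one_le (hspec t ht) hη

/-- The filter of closed unital star subalgebras that approximate finite subsets of `A`. -/
def approxFilter (A : Type*) [CStarAlgebra A] : Filter (StarSubalgebra ℂ A) where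
  sets := {S | ∃ F : Finset A, ∃ ε > 0, ∀ D : StarSubalgebra ℂ A, IsClosed (D : Set A) →
    (∀ x ∈ F, ∃ d ∈ D, ‖x - d‖ < ε) → D ∈ S}
  univ_sets := ⟨∅, 1, one_pos, fun _ _ _ => trivial⟩
  sets_of_superset := by
    rintro S T ⟨F, ε, hε, h⟩ hST
    exact ⟨F, ε, hε, fun D hD hF => hST (h D hD hF)⟩
  inter_sets := by
    classical
    rintro S T ⟨F, ε, hε, h⟩ ⟨F', ε', hε', h'⟩
    refine ⟨F ∪ F', min ε ε', lt_min hε hε', fun D hD hF => ⟨h D hD fun x hx => ?_,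
      h' D hD fun x hx => ?_⟩⟩
    · obtain ⟨d, hd, hxd⟩ := hF x (Finset.mem_union_left _ hx)
      exact ⟨d, hd, hxd.trans_le (min_le_left _ _)⟩
    · obtain ⟨d, hd, hxd⟩ := hF x (Finset.mem_union_right _ hx)
      exact ⟨d, hd, hxd.trans_le (min_le_right _ _)⟩

lemma eventually_isClosed : ∀ᶠ D : StarSubalgebra ℂ A in approxFilter A, IsClosed (D : Set A) :=
  ⟨∅, 1, one_pos, fun _ hD _ => hD⟩

lemma eventually_exists_norm_sub_lt (x : A) {δ : ℝ} (hδ : 0 < δ) :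
    ∀ᶠ D in approxFilter A, ∃ d ∈ D, ‖x - d‖ < δ :=
  ⟨{x}, δ, hδ, fun _ _ h => h x (Finset.mem_singleton_self x)⟩

lemma eventually_exists_mem_nhds (x : A) {V : Set A} (hV : V ∈ 𝓝 x) :
    ∀ᶠ D in approxFilter A, ∃ d ∈ D, d ∈ V := by
  obtain ⟨δ, hδ, h⟩ := Metric.mem_nhds_iff.mp hV
  filter_upwards [eventually_exists_norm_sub_lt x hδ] with D hD
  obtain ⟨d, hd, hxd⟩ := hD
  exact ⟨d, hd, h (by rwa [Metric.mem_ball, dist_comm, dist_eq_norm])⟩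

lemma eventually_exists_selfAdjoint (x : selfAdjoint A) {V : Set (selfAdjoint A)}
    (hV : V ∈ 𝓝 x) : ∀ᶠ D in approxFilter A, ∃ d : selfAdjoint A, (d : A) ∈ D ∧ d ∈ V := by
  have hc : Continuous (realPart : A → selfAdjoint A) := by
    rw [continuous_induced_rng]
    simp only [Function.comp_def, realPart_apply_coe]
    fun_prop
  have hV' : realPart ⁻¹' V ∈ 𝓝 (x : A) := hc.continuousAt.preimage_mem_nhds (by
    rwa [realPart_coe])
  filter_upwards [eventually_exists_mem_nhds (x : A) hV'] with D hD
  obtain ⟨d, hd, hdV⟩ := hD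
  refine ⟨realPart d, ?_, hdV⟩
  rw [realPart_apply_coe]
  have : (2 : ℝ)⁻¹ • (d + star d) = (2 : ℂ)⁻¹ • (d + star d) := by
    rw [← Complex.coe_smul]; simp
  rw [this]
  exact D.smul_mem (add_mem hd (star_mem hd)) _

/-- The group of those unitaries of `A` which lie in the subalgebra `D`. -/
def unitaryIn (D : StarSubalgebra ℂ A) : Subgroup (unitary A) where
  carrier := {u | (u : A) ∈ D}
  mul_mem' hu hv := mul_mem (s := D) hu hv
  one_mem' := one_mem D
  inv_mem' hu := star_mem (s := D) hu

/-- An element of `D` close to `u` is almost unitary; its polar part is taken inside `D`, which is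
itself a C⋆-algebra because it is closed. -/
lemma eventually_exists_unitary (u : unitary A) {V : Set (unitary A)} (hV : V ∈ 𝓝 u) :
    ∀ᶠ D in approxFilter A, ∃ v ∈ unitaryIn D, v ∈ V := by
  obtain ⟨δ, hδ, hball⟩ := Metric.mem_nhds_iff.mp hV
  have hT : Tendsto (fun d : A => (‖star d * d - 1‖ + ‖d * star d - 1‖,
      ‖(u : A) - d‖ + ‖d‖ * (2 * (‖star d * d - 1‖ + ‖d * star d - 1‖)))) (𝓝 (u : A))
      (𝓝 (0, 0)) := by
    have : Continuous (fun d : A => (‖star d * d - 1‖ + ‖d * star d - 1‖,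
      ‖(u : A) - d‖ + ‖d‖ * (2 * (‖star d * d - 1‖ + ‖d * star d - 1‖)))) := by fun_prop
    simpa using this.tendsto (u : A)
  have hmem := hT (prod_mem_nhds (Iio_mem_nhds (show (0 : ℝ) < 1 / 2 by norm_num))
    (Iio_mem_nhds hδ))
  filter_upwards [eventually_isClosed, eventually_exists_mem_nhds (u : A) hmem] with D hD hd
  obtain ⟨d, hd, hd1, hd2⟩ := hd
  simp only [Set.mem_Iio] at hd1 hd2
  have := hD
  obtain ⟨v, hv, hvd⟩ := exists_unitary_norm_sub_le (A := D) (d := ⟨d, hd⟩) hd1.le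
    (le_add_of_nonneg_right (norm_nonneg _)) (le_add_of_nonneg_left (norm_nonneg _))
  have hvA : (v : A) ∈ unitary A :=
    ⟨congrArg Subtype.val hv.1, congrArg Subtype.val hv.2⟩
  refine ⟨⟨v, hvA⟩, v.2, hball ?_⟩
  rw [Metric.mem_ball, Subtype.dist_eq, dist_eq_norm]
  have hvd' : ‖(v : A) - d‖ ≤ ‖d‖ * (2 * (‖star d * d - 1‖ + ‖d * star d - 1‖)) := hvd
  calc ‖(v : A) - u‖ ≤ ‖(v : A) - d‖ + ‖d - u‖ := norm_sub_le_norm_sub_add_norm_sub _ _ _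
    _ < δ := by rw [norm_sub_rev d]; linarith

lemma eventually_exists_commutator {v : unitary A} (hv : v ∈ commutator (unitary A))
    {V : Set (unitary A)} (hV : V ∈ 𝓝 v) :
    ∀ᶠ D in approxFilter A, ∃ w ∈ ⁅unitaryIn D, unitaryIn D⁆, w ∈ V := by
  rw [commutator_eq_closure] at hv
  induction hv using Subgroup.closure_induction generalizing V with
  | mem x hx =>
    obtain ⟨a, b, rfl⟩ := hx
    have hc : Continuous fun p : unitary A × unitary A => ⁅p.1, p.2⁆ := by
      simp only [commutatorElement_def]; fun_prop
    have := hc.continuousAt.preimage_mem_nhds (x := (a, b)) hV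
    rw [nhds_prod_eq, mem_prod_iff] at this
    obtain ⟨Va, hVa, Vb, hVb, hsub⟩ := this
    filter_upwards [eventually_exists_unitary a hVa, eventually_exists_unitary b hVb]
      with D ⟨a', ha', haV⟩ ⟨b', hb', hbV⟩
    exact ⟨⁅a', b'⁆, Subgroup.commutator_mem_commutator ha' hb', hsub (Set.mk_mem_prod haV hbV)⟩
  | one => exact Eventually.of_forall fun D => ⟨1, one_mem _, mem_of_mem_nhds hV⟩
  | mul x y _ _ hx hy =>
    have hc : Continuous fun p : unitary A × unitary A => p.1 * p.2 := by fun_prop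
    have := hc.continuousAt.preimage_mem_nhds (x := (x, y)) hV
    rw [nhds_prod_eq, mem_prod_iff] at this
    obtain ⟨Va, hVa, Vb, hVb, hsub⟩ := this
    filter_upwards [hx hVa, hy hVb] with D ⟨a', ha', haV⟩ ⟨b', hb', hbV⟩
    exact ⟨a' * b', mul_mem ha' hb', hsub (Set.mk_mem_prod haV hbV)⟩
  | inv x _ hx =>
    filter_upwards [hx (continuous_inv.continuousAt.preimage_mem_nhds hV)] with D ⟨a', ha', haV⟩
    exact ⟨a'⁻¹, inv_mem ha', haV⟩

lemma exp_mem_of_isClosed {D : StarSubalgebra ℂ A} (hD : IsClosed (D : Set A)) {x : A}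
    (hx : x ∈ D) : exp x ∈ D := by
  let +nondep : NormedAlgebra ℚ A := .restrictScalars ℚ ℂ A
  let +nondep : NormedAlgebra ℚ D := .restrictScalars ℚ ℂ D
  have := hD.completeSpace_coe
  have := map_exp D.subtype continuous_subtype_val (⟨x, hx⟩ : D)
  rw [← show D.subtype ⟨x, hx⟩ = x from rfl, ← this]
  exact (exp (⟨x, hx⟩ : D)).2

/-- If `exp (i k h) ∈ CU(A)`, then in approximating subalgebras `exp (i k g)`, with `g` close to
`h`, is a small exponential times a product of commutators. -/
lemma eventually_exists_expUnitary_eq {h : selfAdjoint A} {k : ℕ} (hk : expUnitary (k • h) ∈ CU A)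
    {δ : ℝ} (hδ : 0 < δ) : ∀ᶠ D in approxFilter A, ∃ g T : selfAdjoint A, (g : A) ∈ D ∧
      (T : A) ∈ D ∧ ‖(h : A) - g‖ < δ ∧ ‖(T : A)‖ < δ ∧
        ∃ v ∈ ⁅unitaryIn D, unitaryIn D⁆, expUnitary (k • g) = expUnitary T * v := by
  have hexp : Continuous fun g : selfAdjoint A => expUnitary (k • g) :=
    continuous_expUnitary.comp (continuous_const_smul k)
  -- The bound `2` is the range in which the principal logarithm inverts the exponential.
  let W : Set (unitary A) := {w | ‖(w : A) - 1‖ < 2 ∧ ‖(Unitary.argSelfAdjoint w : A)‖ < δ}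
  have hW : W ∈ 𝓝 (1 : unitary A) := by
    have hball : Metric.ball (1 : unitary A) 2 ∈ 𝓝 (1 : unitary A) :=
      Metric.ball_mem_nhds _ two_pos
    have hcont : ContinuousAt (Unitary.argSelfAdjoint : unitary A → selfAdjoint A) 1 :=
      Unitary.continuousOn_argSelfAdjoint.continuousAt hball
    have h0 : (Unitary.argSelfAdjoint (1 : unitary A)) = 0 := by
      have := argSelfAdjoint_expUnitary (A := A) (x := 0) (by simpa using Real.pi_pos)
      rwa [expUnitary_zero] at this
    have h1 : ∀ᶠ w in 𝓝 (1 : unitary A), ‖(Unitary.argSelfAdjoint w : A)‖ < δ := by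
      have hc : ContinuousAt (fun w : unitary A => ‖(Unitary.argSelfAdjoint w : A)‖) 1 :=
        (continuous_subtype_val.continuousAt.comp hcont).norm
      refine hc.eventually (eventually_lt_nhds ?_)
      simpa [h0] using hδ
    filter_upwards [hball, h1] with w hw1 hw2
    exact ⟨by simpa [Subtype.dist_eq, dist_eq_norm] using hw1, hw2⟩
  have hc : Continuous fun p : selfAdjoint A × unitary A => expUnitary (k • p.1) * p.2⁻¹ :=
    (hexp.comp continuous_fst).mul continuous_snd.inv
  have hnhds := hc.continuousAt.preimage_mem_nhds (x := (h, expUnitary (k • h))) (t := W) (by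
    simpa using hW)
  rw [nhds_prod_eq, mem_prod_iff] at hnhds
  obtain ⟨V₁, hV₁, V₂, hV₂, hsub⟩ := hnhds
  obtain ⟨V₃, hV₃, hV₃o, hV₃m⟩ := mem_nhds_iff.mp hV₂
  obtain ⟨v, hvV, hv⟩ := mem_closure_iff.mp (show _ ∈ closure _ from hk) V₃ hV₃o hV₃m
  have hball : {g : selfAdjoint A | ‖(h : A) - g‖ < δ} ∈ 𝓝 h := by
    filter_upwards [Metric.ball_mem_nhds h hδ] with g hg
    rwa [Metric.mem_ball, dist_comm, Subtype.dist_eq, dist_eq_norm] at hg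
  filter_upwards [eventually_isClosed, eventually_exists_selfAdjoint h (inter_mem hV₁ hball),
    eventually_exists_commutator hv (hV₃o.mem_nhds hvV)] with D hD ⟨g, hgD, hgV, hgδ⟩ ⟨w, hw, hwV⟩
  obtain ⟨h1, h2⟩ := hsub (Set.mk_mem_prod hgV (hV₃ hwV))
  simp only at h1 h2
  have hwD : (w : A) ∈ D := Subgroup.commutator_le_self _ hw
  have hmem : ((expUnitary (k • g) * w⁻¹ : unitary A) : A) ∈ D := by
    refine mul_mem ?_ (star_mem hwD)
    rw [expUnitary_coe]
    exact exp_mem_of_isClosed hD (D.smul_mem (nsmul_mem hgD k) _)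
  refine ⟨g, Unitary.argSelfAdjoint (expUnitary (k • g) * w⁻¹), hgD, ?_, hgδ, h2, w, hw, ?_⟩
  · exact cfc_mem (hs := hD) _ hmem
  · rw [expUnitary_argSelfAdjoint h1]
    simp

end Approximation

/-! ### Determinants and sizes of matrix representations -/

section Matrices

open scoped Matrix.Norms.L2Operator

lemma Matrix.IsHermitian.det_exp_I_smul {n : ℕ} {H : Matrix (Fin n) (Fin n) ℂ}
    (hH : H.IsHermitian) : (NormedSpace.exp (I • H)).det = Complex.exp (I * H.trace) := by
  set V : Matrix (Fin n) (Fin n) ℂ := (hH.eigenvectorUnitary : Matrix (Fin n) (Fin n) ℂ) with hV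
  have hVV : V * star V = 1 := Unitary.coe_mul_star_self _
  have hVV' : star V * V = 1 := Unitary.coe_star_mul_self _
  have hu : IsUnit V := ⟨⟨V, star V, hVV, hVV'⟩, rfl⟩
  have hinv : V⁻¹ = star V := Matrix.inv_eq_right_inv hVV
  have hspec : H = V * Matrix.diagonal (fun i => (hH.eigenvalues i : ℂ)) * V⁻¹ := by
    rw [hinv]
    exact hH.spectral_theorem
  have htr : H.trace = ∑ i, (hH.eigenvalues i : ℂ) := hH.trace_eq_sum_eigenvalues
  have hI : I • H = V * Matrix.diagonal (fun i => I * (hH.eigenvalues i : ℂ)) * V⁻¹ := by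
    conv_lhs => rw [hspec]
    rw [← smul_mul_assoc, ← mul_smul_comm, ← Matrix.diagonal_smul]
    rfl
  let +nondep : Algebra ℚ ℂ := inferInstance
  rw [hI, Matrix.exp_conj _ _ hu, Matrix.exp_diagonal, Matrix.det_mul_right_comm, hinv, hVV,
    one_mul, Matrix.det_diagonal, htr, Finset.mul_sum, Complex.exp_sum]
  refine Finset.prod_congr rfl fun i _ => ?_
  rw [Pi.coe_exp, ← Complex.exp_eq_exp_ℂ]

lemma Matrix.norm_entry_le_l2_opNorm {n : ℕ} (M : Matrix (Fin n) (Fin n) ℂ) (i j : Fin n) :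
    ‖M i j‖ ≤ ‖M‖ := by
  have h := M.l2_opNorm_mulVec (EuclideanSpace.single j 1)
  rw [PiLp.norm_single, norm_one, mul_one] at h
  refine le_trans ?_ ((PiLp.norm_apply_le _ i).trans h)
  simp

variable {A : Type*} [CStarAlgebra A]

/-- `det ∘ π` is a homomorphism from the unitaries in `D` to a commutative group. -/
lemma det_eq_one_of_mem_commutator {D : StarSubalgebra ℂ A} {n : ℕ}
    (π : D →⋆ₐ[ℂ] Matrix (Fin n) (Fin n) ℂ) {v : unitary A}
    (hv : v ∈ ⁅unitaryIn D, unitaryIn D⁆) (hvD : (v : A) ∈ D) : (π ⟨v, hvD⟩).det = 1 := by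
  let ρ : unitaryIn D →* ℂ :=
    { toFun := fun u => (π ⟨((u : unitary A) : A), u.2⟩).det
      map_one' := by
        rw [show (⟨(((1 : unitaryIn D) : unitary A) : A), (1 : unitaryIn D).2⟩ : D) = 1 from rfl,
          map_one, Matrix.det_one]
      map_mul' := fun u w => by rw [← Matrix.det_mul, ← map_mul]; rfl }
  rw [← Subgroup.map_subtype_commutator] at hv
  obtain ⟨w, hw, rfl⟩ := hv
  have := Abelianization.commutator_subset_ker ρ.toHomUnits hw
  rw [MonoidHom.mem_ker, Units.ext_iff] at this
  exact this

/-- The de la Harpe–Skandalis determinant obstruction in a matrix representation. -/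
lemma exists_int_trace_eq {D : StarSubalgebra ℂ A} (hD : IsClosed (D : Set A)) {n : ℕ}
    (π : D →⋆ₐ[ℂ] Matrix (Fin n) (Fin n) ℂ) {k : ℕ} {g T : selfAdjoint A} (hg : (g : A) ∈ D)
    (hT : (T : A) ∈ D) {v : unitary A} (hv : v ∈ ⁅unitaryIn D, unitaryIn D⁆)
    (h : expUnitary (k • g) = expUnitary T * v) :
    ∃ m : ℤ, (k : ℂ) * (π ⟨g, hg⟩).trace = (π ⟨T, hT⟩).trace + m * (2 * Real.pi) := by
  have := hD
  let +nondep : NormedAlgebra ℚ A := .restrictScalars ℚ ℂ A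
  let +nondep : NormedAlgebra ℚ D := .restrictScalars ℚ ℂ D
  have hπ : Continuous π := by
    refine AddMonoidHomClass.continuous_of_bound π 1 fun x => ?_
    rw [one_mul]
    exact NonUnitalStarAlgHom.norm_apply_le π x
  have hexp : ∀ x : D, (NormedSpace.exp (I • x : D) : D) = NormedSpace.exp (I • (x : A)) :=
    fun x => map_exp D.subtype continuous_subtype_val (I • x)
  have hdet : ∀ (x : A) (hx : x ∈ D), IsSelfAdjoint x → (π (NormedSpace.exp (I • ⟨x, hx⟩ : D))).det =
      Complex.exp (I * (π ⟨x, hx⟩).trace) := by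
    intro x hx hsa
    rw [← Matrix.IsHermitian.det_exp_I_smul]
    · rw [← map_smul]
      exact congrArg Matrix.det (map_exp π hπ (I • (⟨x, hx⟩ : D)))
    · change star _ = _
      rw [← map_star]
      exact congrArg π (Subtype.ext hsa)
  have hkg : ((k • g : selfAdjoint A) : A) ∈ D := nsmul_mem hg k
  have hvD : (v : A) ∈ D := Subgroup.commutator_le_self _ hv
  have heq : (NormedSpace.exp (I • ⟨_, hkg⟩ : D) : D) =
      NormedSpace.exp (I • ⟨_, hT⟩ : D) * ⟨v, hvD⟩ := by
    apply Subtype.ext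
    rw [MulMemClass.coe_mul, hexp, hexp]
    exact congrArg Subtype.val h
  have h2 := congrArg (fun x => (π x).det) heq
  simp only [map_mul, Matrix.det_mul] at h2
  rw [hdet _ _ (k • g).2, hdet _ _ T.2, det_eq_one_of_mem_commutator π hv, mul_one,
    Complex.exp_eq_exp_iff_exists_int] at h2
  obtain ⟨m, hm⟩ := h2
  refine ⟨m, ?_⟩
  have htr : (π ⟨_, hkg⟩).trace = k * (π ⟨g, hg⟩).trace := by
    rw [show (⟨_, hkg⟩ : D) = k • ⟨g, hg⟩ from rfl, map_nsmul, Matrix.trace_smul, nsmul_eq_mul]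
  rw [htr] at hm
  apply mul_left_cancel₀ I_ne_zero
  rw [hm]
  ring

/-- There are too many vectors `X j ξ` to be independent. Pairing a relation with the vector of
largest coefficient shows that this almost orthogonal vector is short; all the `X j ξ` have nearly
the same length, which `B` controls. -/
lemma norm_le_of_almost_orthogonal {E : Type*} [NormedAddCommGroup E] [InnerProductSpace ℂ E]
    [FiniteDimensional ℂ E] [CompleteSpace E] {m : ℕ} (hm : Module.finrank ℂ E < m) (X : Fin m → E →L[ℂ] E)
    (B : E →L[ℂ] E) {ε : ℝ} (h1 : ∀ j, ‖star (X j) * X j - B‖ ≤ ε)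
    (h2 : ∀ j k, j ≠ k → ‖star (X j) * X k‖ ≤ ε) : ‖B‖ ≤ (m + 3) * ε := by
  have hm0 : 0 < m := by omega
  have hε : 0 ≤ ε := (norm_nonneg _).trans (h1 ⟨0, hm0⟩)
  have hinner : ∀ (S : E →L[ℂ] E) (ξ : E), ‖ξ‖ = 1 → ‖S‖ ≤ ε → ‖inner ℂ ξ (S ξ)‖ ≤ ε := by
    intro S ξ hξ hS
    calc ‖inner ℂ ξ (S ξ)‖ ≤ ‖ξ‖ * ‖S ξ‖ := norm_inner_le_norm _ _
      _ ≤ ‖ξ‖ * (‖S‖ * ‖ξ‖) := by gcongr; exact S.le_opNorm ξ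
      _ ≤ ε := by rw [hξ]; simpa using hS
  have hadj : ∀ j k ξ, inner ℂ ξ ((star (X j) * X k) ξ) = inner ℂ (X j ξ) (X k ξ) := by
    intro j k ξ
    rw [ContinuousLinearMap.star_eq_adjoint, mul_apply_eq_comp,
      ContinuousLinearMap.adjoint_inner_right]
  let j₀ : Fin m := ⟨0, hm0⟩
  have hX : ∀ ξ : E, ‖ξ‖ = 1 → ‖X j₀ ξ‖ ^ 2 ≤ (m + 2) * ε := by
    intro ξ hξ
    have hdep : ¬ LinearIndependent ℂ (fun j => X j ξ) := by
      intro hli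
      have := hli.fintype_card_le_finrank
      rw [Fintype.card_fin] at this
      omega
    rw [Fintype.not_linearIndependent_iff] at hdep
    obtain ⟨c, hc, i, hi⟩ := hdep
    obtain ⟨l, -, hl⟩ := Finset.exists_max_image Finset.univ (fun j => ‖c j‖) ⟨i, Finset.mem_univ i⟩
    have hcl : 0 < ‖c l‖ := lt_of_lt_of_le (norm_pos_iff.mpr hi) (hl i (Finset.mem_univ i))
    have hsum : c l * inner ℂ (X l ξ) (X l ξ) =
        -∑ j ∈ Finset.univ.erase l, c j * inner ℂ (X l ξ) (X j ξ) := by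
      rw [eq_neg_iff_add_eq_zero, Finset.add_sum_erase _
        (fun j => c j * inner ℂ (X l ξ) (X j ξ)) (Finset.mem_univ l)]
      have := congrArg (fun y => inner ℂ (X l ξ) y) hc
      simpa [inner_sum, inner_smul_right] using this
    have hXl : ‖X l ξ‖ ^ 2 ≤ m * ε := by
      have h := congrArg norm hsum
      rw [norm_mul, inner_self_eq_norm_sq_to_K, norm_neg] at h
      have h3 : ‖∑ j ∈ Finset.univ.erase l, c j * inner ℂ (X l ξ) (X j ξ)‖ ≤
          ∑ j : Fin m, ‖c l‖ * ε := by
        refine (norm_sum_le _ _).trans ?_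
        refine (Finset.sum_le_sum (g := fun _ => ‖c l‖ * ε) fun j hj => ?_).trans
          (Finset.sum_le_sum_of_subset_of_nonneg (Finset.subset_univ _)
            fun _ _ _ => by positivity)
        rw [norm_mul, ← hadj]
        exact mul_le_mul (hl j (Finset.mem_univ j))
          (hinner _ _ hξ (h2 l j (Finset.ne_of_mem_erase hj).symm)) (norm_nonneg _)
          (norm_nonneg _)
      rw [← h] at h3
      simp only [Finset.sum_const, Finset.card_univ, Fintype.card_fin, nsmul_eq_mul] at h3
      have h4 : ‖c l‖ * ‖X l ξ‖ ^ 2 ≤ ‖c l‖ * (m * ε) := by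
        have : ‖(((‖X l ξ‖ : ℝ) : ℂ) ^ 2)‖ = ‖X l ξ‖ ^ 2 := by
          rw [norm_pow, Complex.norm_real, norm_norm]
        calc ‖c l‖ * ‖X l ξ‖ ^ 2 = ‖c l‖ * ‖(((‖X l ξ‖ : ℝ) : ℂ) ^ 2)‖ := by rw [this]
          _ ≤ m * (‖c l‖ * ε) := h3
          _ = ‖c l‖ * (m * ε) := by ring
      exact le_of_mul_le_mul_left h4 hcl
    have hdiff : ‖star (X j₀) * X j₀ - star (X l) * X l‖ ≤ 2 * ε := by
      have : star (X j₀) * X j₀ - star (X l) * X l =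
          (star (X j₀) * X j₀ - B) - (star (X l) * X l - B) := by abel
      rw [this]
      refine (norm_sub_le _ _).trans ?_
      linarith [h1 j₀, h1 l]
    have h5 : ‖inner ℂ ξ ((star (X j₀) * X j₀ - star (X l) * X l) ξ)‖ ≤ 2 * ε := by
      calc _ ≤ ‖ξ‖ * ‖(star (X j₀) * X j₀ - star (X l) * X l) ξ‖ := norm_inner_le_norm _ _
        _ ≤ ‖ξ‖ * (‖star (X j₀) * X j₀ - star (X l) * X l‖ * ‖ξ‖) := by
          gcongr; exact ContinuousLinearMap.le_opNorm _ ξ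
        _ ≤ 2 * ε := by rw [hξ]; simpa using hdiff
    rw [_root_.sub_apply, inner_sub_right, hadj, hadj, inner_self_eq_norm_sq_to_K,
      inner_self_eq_norm_sq_to_K] at h5
    have h6 : ‖X j₀ ξ‖ ^ 2 - ‖X l ξ‖ ^ 2 ≤ 2 * ε := by
      refine le_trans (le_abs_self _) (le_trans (le_of_eq ?_) h5)
      rw [← Real.norm_eq_abs, ← Complex.norm_real]
      push_cast
      rfl
    linarith
  have hXX : ‖star (X j₀) * X j₀‖ ≤ (m + 2) * ε := by
    rw [CStarRing.norm_star_mul_self, ← sq]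
    have : ‖X j₀‖ ≤ √((m + 2) * ε) := by
      refine ContinuousLinearMap.opNorm_le_of_unit_norm (Real.sqrt_nonneg _) fun ξ hξ => ?_
      exact Real.le_sqrt_of_sq_le (hX ξ hξ)
    calc ‖X j₀‖ ^ 2 ≤ √((m + 2) * ε) ^ 2 := by gcongr
      _ = (m + 2) * ε := Real.sq_sqrt (by positivity)
  have : B = star (X j₀) * X j₀ - (star (X j₀) * X j₀ - B) := by abel
  rw [this]
  refine (norm_sub_le _ _).trans ?_
  linarith [h1 j₀]

lemma eventually_exists_pi {ι : Type*} [Finite ι] (x : ι → A) {V : Set (ι → A)} (hV : V ∈ 𝓝 x) :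
    ∀ᶠ D in approxFilter A, ∃ d : ι → A, (∀ i, d i ∈ D) ∧ d ∈ V := by
  rw [nhds_pi, Filter.mem_pi'] at hV
  obtain ⟨I, t, ht, hsub⟩ := hV
  have := eventually_all.mpr fun i => eventually_exists_mem_nhds (x i) (ht i)
  filter_upwards [this] with D hD
  choose d hd hdt using hD
  exact ⟨d, hd, hsub fun i _ => hdt i⟩

/-- Subalgebras that approximate a simple infinite dimensional C⋆-algebra well have only large
matrix representations. -/
lemma eventually_le_of_starAlgHom (hA : IsSimpleCStarAlgebra A) {m : ℕ} {x : Fin m → A} {b : A}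
    (hb : b ≠ 0) (h1 : ∀ j, star (x j) * x j = b) (h2 : ∀ j k, j ≠ k → star (x j) * x k = 0) :
    ∀ᶠ D : StarSubalgebra ℂ A in approxFilter A, ∀ n : ℕ, 0 < n →
      (D →⋆ₐ[ℂ] Matrix (Fin n) (Fin n) ℂ) → m ≤ n := by
  obtain ⟨L, r, s, hrs⟩ := hA.exists_sum_mul_mul_eq_one hb
  set K : ℝ := ∑ i, ‖r i‖ * ‖s i‖ + 1 with hK
  have hK0 : 0 < K := by positivity
  -- Chosen so that `K (m + 3) ε = 1/4`: in a representation of size below `m` the unit would have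
  -- norm at most `1/2 + 1/4`.
  set ε : ℝ := 1 / (4 * K * (m + 3)) with hε
  have hε0 : 0 < ε := by positivity
  let ι := Unit ⊕ Fin m ⊕ Fin L ⊕ Fin L
  let x₀ : ι → A := Sum.elim (fun _ => b) (Sum.elim x (Sum.elim r s))
  let V : Set (ι → A) := {y | (∀ j, ‖star (y (.inr (.inl j))) * y (.inr (.inl j)) - y (.inl ())‖ < ε) ∧
    (∀ j k, j ≠ k → ‖star (y (.inr (.inl j))) * y (.inr (.inl k))‖ < ε) ∧
    ‖∑ i, y (.inr (.inr (.inl i))) * y (.inl ()) * y (.inr (.inr (.inr i))) - 1‖ < 1 / 2 ∧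
    ∑ i, ‖y (.inr (.inr (.inl i)))‖ * ‖y (.inr (.inr (.inr i)))‖ < K}
  have hV : V ∈ 𝓝 x₀ := by
    refine inter_mem ?_ (inter_mem ?_ (inter_mem ?_ ?_))
    · refine eventually_all.mpr fun j => ?_
      have : Continuous fun y : ι → A =>
          ‖star (y (.inr (.inl j))) * y (.inr (.inl j)) - y (.inl ())‖ := by fun_prop
      refine this.continuousAt.eventually (eventually_lt_nhds ?_)
      simpa [x₀, h1] using hε0
    · refine eventually_all.mpr fun j => eventually_all.mpr fun k => ?_
      by_cases hjk : j = k
      · exact Eventually.of_forall fun y h => absurd hjk h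
      have : Continuous fun y : ι → A =>
          ‖star (y (.inr (.inl j))) * y (.inr (.inl k))‖ := by fun_prop
      refine (this.continuousAt.eventually (eventually_lt_nhds ?_)).mono fun y hy _ => hy
      simpa [x₀, h2 j k hjk] using hε0
    · have : Continuous fun y : ι → A =>
          ‖∑ i, y (.inr (.inr (.inl i))) * y (.inl ()) * y (.inr (.inr (.inr i))) - 1‖ := by fun_prop
      refine this.continuousAt.eventually (eventually_lt_nhds ?_)
      simp [x₀, hrs]
    · have : Continuous fun y : ι → A =>
          ∑ i, ‖y (.inr (.inr (.inl i)))‖ * ‖y (.inr (.inr (.inr i)))‖ := by fun_prop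
      refine this.continuousAt.eventually (eventually_lt_nhds ?_)
      simp [x₀, hK]
  filter_upwards [eventually_isClosed, eventually_exists_pi x₀ hV] with D hD ⟨y, hyD, hy1, hy2, hy3, hy4⟩
  intro n hn π
  have := hD
  by_contra hnm
  have hcontr : ∀ d : D, ‖π d‖ ≤ ‖(d : A)‖ := NonUnitalStarAlgHom.norm_apply_le π
  let y' : ι → D := fun i => ⟨y i, hyD i⟩
  let Φ := Matrix.toEuclideanCLM (n := Fin n) (𝕜 := ℂ)
  have hB : ‖Φ (π (y' (.inl ())))‖ ≤ (m + 3) * ε := by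
    refine norm_le_of_almost_orthogonal (by simpa using hnm) (fun j => Φ (π (y' (.inr (.inl j))))) _
      (fun j => ?_) fun j k hjk => ?_
    · rw [← map_star, ← map_star, ← map_mul, ← map_mul, ← map_sub, ← map_sub]
      exact (hcontr _).trans (hy1 j).le
    · rw [← map_star, ← map_star, ← map_mul, ← map_mul]
      exact (hcontr _).trans (hy2 j k hjk).le
  replace hB : ‖π (y' (.inl ()))‖ ≤ (m + 3) * ε := hB
  have hne : Nonempty (Fin n) := ⟨⟨0, hn⟩⟩
  have hone : ‖(1 : Matrix (Fin n) (Fin n) ℂ)‖ = 1 := norm_one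
  have hdiff : ‖∑ i, π (y' (.inr (.inr (.inl i)))) * π (y' (.inl ())) *
      π (y' (.inr (.inr (.inr i)))) - 1‖ ≤ 1 / 2 := by
    simp only [← map_mul]
    rw [← map_sum, ← map_one π, ← map_sub]
    refine (hcontr _).trans (le_of_eq_of_le ?_ hy3.le)
    congr 1
    push_cast
    rfl
  have hsum : ‖∑ i, π (y' (.inr (.inr (.inl i)))) * π (y' (.inl ())) *
      π (y' (.inr (.inr (.inr i))))‖ ≤ K * ((m + 3) * ε) := by
    refine (norm_sum_le _ _).trans ?_
    calc _ ≤ ∑ i, ‖y (.inr (.inr (.inl i)))‖ * ‖y (.inr (.inr (.inr i)))‖ * ((m + 3) * ε) := by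
          refine Finset.sum_le_sum fun i _ => ?_
          calc _ ≤ ‖π (y' (.inr (.inr (.inl i))))‖ * ‖π (y' (.inl ()))‖ *
                ‖π (y' (.inr (.inr (.inr i))))‖ :=
                (norm_mul_le _ _).trans (mul_le_mul_of_nonneg_right (norm_mul_le _ _)
                  (norm_nonneg _))
            _ ≤ ‖y (.inr (.inr (.inl i)))‖ * ((m + 3) * ε) * ‖y (.inr (.inr (.inr i)))‖ := by
                gcongr
                · exact hcontr _
                · exact hcontr _
            _ = _ := by ring
      _ = (∑ i, ‖y (.inr (.inr (.inl i)))‖ * ‖y (.inr (.inr (.inr i)))‖) * ((m + 3) * ε) :=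
          (Finset.sum_mul _ _ _).symm
      _ ≤ K * ((m + 3) * ε) := by gcongr
  have hquarter : K * ((m + 3) * ε) = 1 / 4 := by
    rw [hε]; field_simp
  have := norm_sub_norm_le (1 : Matrix (Fin n) (Fin n) ℂ)
    (∑ i, π (y' (.inr (.inr (.inl i)))) * π (y' (.inl ())) * π (y' (.inr (.inr (.inr i)))))
  rw [norm_sub_rev, hone] at this
  linarith

end Matrices

/-! ### Trace-zero matrices are sums of commutators -/

section TraceZero

/-- Off-diagonal matrix units are commutators, and commutators move every diagonal entry to one
fixed position, where the entries add up to the trace. -/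
lemma Matrix.mem_of_trace_eq_zero {R : Type*} [CommRing R] {n : ℕ}
    (K : AddSubgroup (Matrix (Fin n) (Fin n) R)) (hK : ∀ c d, c * d - d * c ∈ K)
    {M : Matrix (Fin n) (Fin n) R} (hM : M.trace = 0) : M ∈ K := by
  rcases Nat.eq_zero_or_pos n with rfl | hn
  · rw [Subsingleton.elim M 0]; exact zero_mem K
  let z : Fin n := ⟨0, hn⟩
  have key : ∀ a b : Fin n, Matrix.single a b (M a b) -
      (if a = b then Matrix.single z z (M a b) else 0) ∈ K := by
    intro a b
    split_ifs with hab
    · subst hab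
      have := hK (Matrix.single a z (M a a)) (Matrix.single z a 1)
      simpa using this
    · have := hK (Matrix.single a a (M a b)) (Matrix.single a b 1)
      simpa [Matrix.single_mul_single_of_ne _ _ _ _ (Ne.symm hab)] using this
  have hsum := sum_mem fun a (_ : a ∈ Finset.univ) => sum_mem fun b (_ : b ∈ Finset.univ) => key a b
  have hzero : ∑ a, ∑ b, (if a = b then Matrix.single z z (M a b) else 0) = 0 := by
    simp only [Finset.sum_ite_eq, Finset.mem_univ, if_true]
    have := (map_sum (Matrix.singleAddMonoidHom z z) (fun a => M a a) Finset.univ).symm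
    simp only [Matrix.singleAddMonoidHom_apply] at this
    rw [this, show ∑ a, M a a = 0 from hM, Matrix.single_zero]
  simp only [Finset.sum_sub_distrib] at hsum
  rwa [hzero, sub_zero, ← Matrix.matrix_eq_sum_single] at hsum

lemma Pi.matrix_mem_of_trace_eq_zero {ι : Type*} [Finite ι] {n : ι → ℕ} {R : ι → Type*}
    [∀ i, CommRing (R i)] (K : AddSubgroup (∀ i, Matrix (Fin (n i)) (Fin (n i)) (R i)))
    (hK : ∀ c d, c * d - d * c ∈ K) {M : ∀ i, Matrix (Fin (n i)) (Fin (n i)) (R i)}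
    (hM : ∀ i, (M i).trace = 0) : M ∈ K := by
  classical
  have := Fintype.ofFinite ι
  rw [← Finset.univ_sum_single M]
  refine sum_mem fun i _ => ?_
  refine Matrix.mem_of_trace_eq_zero (K.comap (AddMonoidHom.single
    (fun i => Matrix (Fin (n i)) (Fin (n i)) (R i)) i)) (fun c d => ?_) (hM i)
  have := hK (Pi.single i c) (Pi.single i d)
  rw [← Pi.single_mul, ← Pi.single_mul, ← Pi.single_sub] at this
  exact this

end TraceZero

/-! ### Reducing block matrices to diagonal ones -/

section Blocks

variable {A : Type*} [CStarAlgebra A] {ι : Type*} {n : ι → ℕ} {X : ι → Type*}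
  [∀ i, TopologicalSpace (X i)]

lemma norm_le_of_spectrum {a : A} (ha : IsSelfAdjoint a) {η : ℝ} (hη : 0 ≤ η)
    (h : ∀ z ∈ spectrum ℂ a, ‖z‖ ≤ η) : ‖a‖ ≤ η := by
  have h1 : spectralRadius ℂ a ≤ ENNReal.ofReal η := by
    refine iSup₂_le fun z hz => ?_
    rw [← enorm_eq_nnnorm, ← ofReal_norm]
    exact ENNReal.ofReal_le_ofReal (h z hz)
  rw [ha.spectralRadius_eq_nnnorm] at h1
  rwa [← enorm_eq_nnnorm, ← ofReal_norm, ENNReal.ofReal_le_ofReal_iff hη] at h1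

lemma expUnitary_eq_one_of_spectrum {a : selfAdjoint A}
    (h : ∀ z ∈ spectrum ℂ (a : A), Complex.exp (I * z) = 1) : expUnitary a = 1 := by
  ext
  rw [expUnitary_coe, ← CFC.exp_eq_normedSpace_exp (𝕜 := ℂ), ← cfc_comp_smul I _ (a : A)]
  rw [OneMemClass.coe_one, ← cfc_one ℂ (a : A)]
  refine cfc_congr fun z hz => ?_
  simpa [← Complex.exp_eq_exp_ℂ] using h z hz

/-- Since `θ` need not be unital, only quasispectra are comparable, whence the extra value `0`. It
is harmless below, as `exp(i·0) = 1` and `|0| ≤ η`. -/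
lemma spectrum_nonUnitalAlgHom_subset (θ : (∀ i, C(X i, ℂ)) →ₙₐ[ℂ] A) (f : ∀ i, C(X i, ℂ))
    {z : ℂ} (hz : z ∈ spectrum ℂ (θ f)) : z = 0 ∨ ∃ i x, f i x = z := by
  have h1 := NonUnitalAlgHom.quasispectrum_apply_subset θ f (spectrum_subset_quasispectrum ℂ _ hz)
  rw [quasispectrum_eq_spectrum_union_zero] at h1
  rcases h1 with h1 | h1
  · right
    by_contra! hne
    apply h1
    rw [spectrum.mem_resolventSet_iff, Pi.isUnit_iff]
    intro i
    rw [ContinuousMap.isUnit_iff_forall_ne_zero]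
    intro x hx
    apply hne i x
    have : z - f i x = 0 := by simpa using hx
    exact (sub_eq_zero.mp this).symm
  · left; exact h1

/-- The diagonal embedding of tuples of functions into the diagonal positions marked by `P`. -/
noncomputable def diagHom (n : ι → ℕ) (X : ι → Type*) [∀ i, TopologicalSpace (X i)] (P : ∀ i, Fin (n i) → Prop)
    [∀ i a, Decidable (P i a)] :
    (∀ i, C(X i, ℂ)) →⋆ₙₐ[ℂ] (∀ i, Matrix (Fin (n i)) (Fin (n i)) C(X i, ℂ)) where
  toFun f i := Matrix.diagonal fun a => if P i a then f i else 0
  map_smul' c f := by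
    funext i
    change Matrix.diagonal (fun a => if P i a then c • f i else 0) =
      c • Matrix.diagonal (fun a => if P i a then f i else 0)
    ext a b x
    by_cases hab : a = b
    · subst hab
      by_cases h : P i a <;> simp [h]
    · simp [hab]
  map_zero' := by
    ext i : 1
    simp
  map_add' f g := by
    funext i
    change Matrix.diagonal (fun a => if P i a then f i + g i else 0) =
      Matrix.diagonal (fun a => if P i a then f i else 0) + Matrix.diagonal (fun a => if P i a then g i else 0)
    rw [Matrix.diagonal_add]
    congr 1; ext a : 1
    split_ifs <;> simp
  map_mul' f g := by
    funext i
    change Matrix.diagonal (fun a => if P i a then f i * g i else 0) =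
      Matrix.diagonal (fun a => if P i a then f i else 0) * Matrix.diagonal (fun a => if P i a then g i else 0)
    rw [Matrix.diagonal_mul_diagonal]
    congr 1; ext a : 1
    split_ifs <;> simp
  map_star' f := by
    funext i
    change Matrix.diagonal (fun a => if P i a then star (f i) else 0) =
      star (Matrix.diagonal (fun a => if P i a then f i else 0))
    rw [Matrix.star_eq_conjTranspose, Matrix.diagonal_conjTranspose]
    congr 1; ext a : 1
    by_cases h : P i a <;> simp [h]

lemma trace_diagHom (P : ∀ i, Fin (n i) → Prop) [∀ i a, Decidable (P i a)] (f : ∀ i, C(X i, ℂ))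
    (i : ι) : (diagHom n X P f i).trace = (Finset.univ.filter (P i)).card • f i := by
  simp [diagHom, Matrix.trace_diagonal, Finset.sum_ite]

variable [Finite ι]

/-- A block diagonal element whose traces are integral up to a small error is small modulo
`logCU`. -/
lemma exists_norm_le_of_trace_eq
    (Ψ : (∀ i, Matrix (Fin (n i)) (Fin (n i)) C(X i, ℂ)) →⋆ₙₐ[ℂ] A) (hn : ∀ i, 0 < n i)
    (G : ∀ i, Matrix (Fin (n i)) (Fin (n i)) C(X i, ℂ)) (q : ∀ i, C(X i, ℤ)) (s : ∀ i, C(X i, ℝ))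
    (hG : ∀ i x, (G i).trace x = 2 * Real.pi * (q i x : ℂ) + (s i x : ℝ)) {η : ℝ} (hη : 0 ≤ η)
    (hs : ∀ i x, |s i x| ≤ η * n i) : ∃ a, Ψ G - a ∈ logCU A ∧ ‖a‖ ≤ η := by
  let fq : ∀ i, C(X i, ℂ) := fun i => ⟨fun x => ((2 * Real.pi * (q i x : ℝ) : ℝ) : ℂ), by fun_prop⟩
  let fs : ∀ i, C(X i, ℂ) := fun i => ⟨fun x => ((s i x / n i : ℝ) : ℂ), by fun_prop⟩
  -- `E fq` carries the integral part of the trace in one diagonal entry, so it exponentiates to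
  -- `1`; `S fs` spreads the error over all `n i` entries, which divides its norm by `n i`. Together
  -- they have the traces of `G`.
  let E := diagHom n X (fun i a => a = ⟨0, hn i⟩)
  let S := diagHom n X (fun _ _ => True)
  have hfq : star fq = fq := by
    ext i x; exact Complex.conj_ofReal _
  have hfs : star fs = fs := by
    ext i x; exact Complex.conj_ofReal _
  have hsaE : IsSelfAdjoint (Ψ (E fq)) := by
    rw [IsSelfAdjoint, ← map_star, ← map_star, hfq]
  have hsaS : IsSelfAdjoint (Ψ (S fs)) := by
    rw [IsSelfAdjoint, ← map_star, ← map_star, hfs]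
  refine ⟨Ψ (S fs), ?_, ?_⟩
  · have h1 : Ψ (E fq) ∈ logCU A := by
      have : ((⟨Ψ (E fq), hsaE⟩ : selfAdjoint A) : A) ∈ logCU A := by
        rw [coe_mem_logCU, expUnitary_eq_one_of_spectrum]
        · exact one_mem _
        · intro z hz
          rcases spectrum_nonUnitalAlgHom_subset ((Ψ.comp E : _ →⋆ₙₐ[ℂ] A) : _ →ₙₐ[ℂ] A) fq hz with
            rfl | ⟨i, x, rfl⟩
          · simp
          · rw [Complex.exp_eq_one_iff]
            refine ⟨q i x, ?_⟩
            simp only [fq, ContinuousMap.coe_mk]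
            push_cast
            ring
      exact this
    have h2 : Ψ (G - E fq - S fs) ∈ logCU A := by
      refine Pi.matrix_mem_of_trace_eq_zero ((logCU A).comap (AddMonoidHomClass.toAddMonoidHom Ψ)) (fun c d => ?_)
        fun i => ?_
      · change Ψ (c * d - d * c) ∈ logCU A
        rw [map_sub, map_mul, map_mul]
        exact commutator_mem_logCU _ _
      · rw [Pi.sub_apply, Pi.sub_apply, Matrix.trace_sub, Matrix.trace_sub, trace_diagHom,
          trace_diagHom]
        ext x
        have hn0 : (n i : ℂ) ≠ 0 := by exact_mod_cast (hn i).ne'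
        simp only [ContinuousMap.sub_apply, ContinuousMap.zero_apply, hG i x, ContinuousMap.smul_apply,
          Finset.filter_true, Finset.card_univ, Fintype.card_fin, Finset.filter_eq',
          Finset.mem_univ, if_true, Finset.card_singleton, fq, fs, ContinuousMap.coe_mk, one_smul]
        rw [nsmul_eq_mul]
        push_cast
        field_simp
        ring
    have := add_mem h2 h1
    rw [map_sub, map_sub] at this
    convert! this using 1
    abel
  · refine norm_le_of_spectrum hsaS hη fun z hz => ?_
    rcases spectrum_nonUnitalAlgHom_subset ((Ψ.comp S : _ →⋆ₙₐ[ℂ] A) : _ →ₙₐ[ℂ] A) fs hz with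
      rfl | ⟨i, x, rfl⟩
    · simpa using hη
    · have hn0 : (0 : ℝ) < n i := by exact_mod_cast hn i
      simp only [fs, ContinuousMap.coe_mk]
      rw [Complex.norm_real, Real.norm_eq_abs, abs_div, abs_of_pos hn0, div_le_iff₀ hn0]
      exact hs i x

end Blocks

/-! ### Averaging over orthogonal copies -/

section Spread

variable {A : Type*} [CStarAlgebra A] [PartialOrder A] [StarOrderedRing A]

/-- An element of a corner which has `m` orthogonal equivalent copies is small modulo `logCU`. -/
lemma exists_norm_le_of_copies {m : ℕ} (hm : 0 < m) {f : A} (hf : f * f = f) {v : Fin m → A}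
    (h1 : ∀ j, star (v j) * v j = f) (h2 : ∀ j k, j ≠ k → star (v j) * v k = 0) {y : A}
    (hy : IsSelfAdjoint y) (hfy : f * y = y) : ∃ s, y - s ∈ logCU A ∧ ‖s‖ ≤ ‖y‖ / m := by
  have hm0 : (m : ℝ) ≠ 0 := by positivity
  set y' : A := (m : ℝ)⁻¹ • y with hy'
  have hfy' : f * y' = y' := by rw [hy', mul_smul_comm, hfy]
  have hy'sa : IsSelfAdjoint y' := (IsSelfAdjoint.all _).smul hy
  have hnorm : ‖y'‖ = ‖y‖ / m := by
    rw [hy', norm_smul, norm_inv, Real.norm_natCast, inv_mul_eq_div]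
  have hvf : ∀ j, v j * f = v j := by
    intro j
    have hfs : star f = f := by rw [← h1 j, star_mul, star_star]
    rw [← sub_eq_zero, ← CStarRing.star_mul_self_eq_zero_iff]
    rw [star_sub, star_mul, hfs]
    calc (f * star (v j) - star (v j)) * (v j * f - v j)
        = f * (star (v j) * v j) * f - f * (star (v j) * v j) - (star (v j) * v j) * f +
          star (v j) * v j := by noncomm_ring
      _ = 0 := by rw [h1, hf, hf]; abel
  -- The copies are orthogonal, so `P` is a projection and the sum of the `m` copies of `y/m` still
  -- has norm at most `‖y‖/m`; that sum differs from `y` by commutators.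
  set P : A := ∑ j, v j * star (v j) with hP
  have hPP : IsStarProjection P := by
    refine ⟨?_, isSelfAdjoint_sum _ fun j _ => IsSelfAdjoint.mul_star_self (v j)⟩
    change P * P = P
    rw [hP, Finset.sum_mul_sum]
    refine Finset.sum_congr rfl fun j _ => ?_
    rw [Finset.sum_eq_single j]
    · calc v j * star (v j) * (v j * star (v j)) = v j * (star (v j) * v j) * star (v j) := by
            simp only [mul_assoc]
        _ = _ := by rw [h1, hvf]
    · intro k _ hk
      calc v j * star (v j) * (v k * star (v k)) = v j * (star (v j) * v k) * star (v k) := by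
            simp only [mul_assoc]
        _ = 0 := by rw [h2 j k hk.symm]; simp
    · simp
  have hP1 : P ≤ 1 := hPP.le_one
  have hle : ∀ z : A, IsSelfAdjoint z → ∑ j, v j * z * star (v j) ≤ algebraMap ℝ A ‖z‖ := by
    intro z hz
    calc ∑ j, v j * z * star (v j) ≤ ∑ j, ‖z‖ • (v j * star (v j)) :=
          Finset.sum_le_sum fun j _ => CStarAlgebra.star_right_conjugate_le_norm_smul hz
      _ = ‖z‖ • P := by rw [hP, Finset.smul_sum]
      _ ≤ ‖z‖ • 1 := smul_le_smul_of_nonneg_left hP1 (norm_nonneg _)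
      _ = algebraMap ℝ A ‖z‖ := (Algebra.algebraMap_eq_smul_one _).symm
  refine ⟨∑ j, v j * y' * star (v j), ?_, ?_⟩
  · have : y - ∑ j, v j * y' * star (v j) =
        ∑ j : Fin m, -((v j * y') * star (v j) - star (v j) * (v j * y')) := by
      simp only [neg_sub, ← mul_assoc, h1, hfy', Finset.sum_sub_distrib, Finset.sum_const,
        Finset.card_univ, Fintype.card_fin]
      rw [hy', ← Nat.cast_smul_eq_nsmul ℝ, smul_smul, mul_inv_cancel₀ hm0, one_smul]
    rw [this]
    exact sum_mem fun j _ => neg_mem (commutator_mem_logCU _ _)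
  · rw [← hnorm]
    set s : A := ∑ j, v j * y' * star (v j) with hs
    have hssa : IsSelfAdjoint s := isSelfAdjoint_sum _ fun j _ => hy'sa.conjugate (v j)
    by_cases hnt : Nontrivial A
    swap
    · rw [not_nontrivial_iff_subsingleton] at hnt
      rw [Subsingleton.elim s 0, norm_zero]; exact norm_nonneg _
    have hns : -s ≤ algebraMap ℝ A ‖y'‖ := by
      have := hle (-y') hy'sa.neg
      simpa [hs] using this
    rcases CStarAlgebra.norm_or_neg_norm_mem_spectrum hssa with h | h
    · exact (le_algebraMap_iff_spectrum_le hssa).mp (hle y' hy'sa) _ h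
    · refine (le_algebraMap_iff_spectrum_le hssa.neg).mp hns _ ?_
      rw [← spectrum.neg_eq]
      simpa using h

end Spread

/-! ### The subalgebra attached to a projection and its evaluations -/

section Corner

variable {A : Type*} [CStarAlgebra A]

/-- The subalgebra of elements that commute with the projection `p` and whose corner at `p` lies
in `C`. -/
def cornerSubalgebra (p : A) (C : NonUnitalStarSubalgebra ℂ A) (hp : IsStarProjection p)
    (hpC : p ∈ C) : StarSubalgebra ℂ A where
  carrier := {d | p * d = d * p ∧ p * d ∈ C}
  mul_mem' := by
    rintro c d ⟨hc, hcC⟩ ⟨hd, hdC⟩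
    refine ⟨by rw [← mul_assoc, hc, mul_assoc, hd, mul_assoc], ?_⟩
    have : p * (c * d) = (p * c) * (p * d) := by
      rw [hc, mul_assoc, ← mul_assoc p p, hp.isIdempotentElem.eq, ← mul_assoc, hc, mul_assoc]
    rw [this]
    exact mul_mem hcC hdC
  one_mem' := ⟨by simp, by simpa using hpC⟩
  add_mem' := by
    rintro c d ⟨hc, hcC⟩ ⟨hd, hdC⟩
    exact ⟨by rw [mul_add, add_mul, hc, hd], by rw [mul_add]; exact add_mem hcC hdC⟩
  zero_mem' := ⟨by simp, by simp⟩
  algebraMap_mem' r := by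
    refine ⟨(Algebra.commutes r p).symm, ?_⟩
    rw [← Algebra.commutes, ← Algebra.smul_def]
    exact SMulMemClass.smul_mem r hpC
  star_mem' := by
    rintro d ⟨hd, hdC⟩
    have h : p * star d = star d * p := by
      have := congrArg star hd
      rw [star_mul, star_mul, hp.isSelfAdjoint.star_eq] at this
      exact this.symm
    refine ⟨h, ?_⟩
    have : p * star d = star (p * d) := by
      rw [star_mul, hp.isSelfAdjoint.star_eq, h]
    rw [this]
    exact star_mem hdC

variable {p : A} {C : NonUnitalStarSubalgebra ℂ A} {hp : IsStarProjection p} {hpC : p ∈ C}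

lemma mem_cornerSubalgebra {d : A} :
    d ∈ cornerSubalgebra p C hp hpC ↔ p * d = d * p ∧ p * d ∈ C := Iff.rfl

lemma isClosed_cornerSubalgebra (hC : IsClosed (C : Set A)) :
    IsClosed (cornerSubalgebra p C hp hpC : Set A) := by
  have h1 : IsClosed {d : A | p * d = d * p} := isClosed_eq (by fun_prop) (by fun_prop)
  have h2 : IsClosed {d : A | p * d ∈ C} := hC.preimage (by fun_prop : Continuous fun d => p * d)
  exact h1.inter h2

/-- Evaluation of the corner of an element of `cornerSubalgebra` at a point of a block. -/
noncomputable def cornerEval {k : ℕ} {n : Fin k → ℕ} {X : Fin k → Type*} [∀ i, TopologicalSpace (X i)]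
    (Φ : C ≃⋆ₐ[ℂ] ((i : Fin k) → Matrix (Fin (n i)) (Fin (n i)) C(X i, ℂ)))
    (hunit : ∀ c ∈ C, p * c = c ∧ c * p = c) (i : Fin k) (x : X i) :
    cornerSubalgebra p C hp hpC →⋆ₐ[ℂ] Matrix (Fin (n i)) (Fin (n i)) ℂ :=
  -- As `p` is the unit of `C`, the evaluations come out unital on all of `cornerSubalgebra`.
  have hΦ : Φ ⟨p, hpC⟩ = 1 := by
    have h : ∀ y, Φ ⟨p, hpC⟩ * y = y := by
      intro y
      obtain ⟨c, rfl⟩ := Φ.surjective y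
      have h := map_mul Φ ⟨p, hpC⟩ c
      rw [show (⟨p, hpC⟩ : C) * c = c from Subtype.ext (hunit c c.2).1] at h
      exact h.symm
    rw [← h 1, mul_one]
  { toFun := fun d => (Φ ⟨p * d, d.2.2⟩ i).map fun f => f x
    map_one' := by
      have : Φ ⟨p * ((1 : cornerSubalgebra p C hp hpC) : A), (1 : cornerSubalgebra p C hp hpC).2.2⟩
          = 1 := by
        rw [← hΦ]; exact congrArg Φ (Subtype.ext (mul_one p))
      rw [this, Pi.one_apply, Matrix.map_one _ (by simp) (by simp)]
    map_mul' := fun c d => by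
      have : Φ ⟨p * ((c * d : cornerSubalgebra p C hp hpC) : A), (c * d).2.2⟩ =
          Φ ⟨p * c, c.2.2⟩ * Φ ⟨p * d, d.2.2⟩ := by
        rw [← map_mul]
        refine congrArg Φ (Subtype.ext ?_)
        change p * ((c : A) * d) = (p * c) * (p * d)
        rw [c.2.1, mul_assoc (c : A), ← mul_assoc p p, hp.isIdempotentElem.eq, ← mul_assoc,
          c.2.1, mul_assoc]
      rw [this, Pi.mul_apply]
      exact Matrix.map_mul (f := ContinuousMap.evalAlgHom ℂ ℂ x)
    map_zero' := by
      have : Φ ⟨p * ((0 : cornerSubalgebra p C hp hpC) : A), (0 : cornerSubalgebra p C hp hpC).2.2⟩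
          = 0 := by
        rw [← map_zero Φ]; exact congrArg Φ (Subtype.ext (mul_zero p))
      rw [this, Pi.zero_apply, Matrix.map_zero _ (by simp)]
    map_add' := fun c d => by
      have : Φ ⟨p * ((c + d : cornerSubalgebra p C hp hpC) : A), (c + d).2.2⟩ =
          Φ ⟨p * c, c.2.2⟩ + Φ ⟨p * d, d.2.2⟩ := by
        rw [← map_add]
        exact congrArg Φ (Subtype.ext (mul_add p _ _))
      rw [this, Pi.add_apply, Matrix.map_add _ (by simp)]
    commutes' := fun r => by
      have : Φ ⟨p * ((algebraMap ℂ (cornerSubalgebra p C hp hpC) r :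
          cornerSubalgebra p C hp hpC) : A), (algebraMap ℂ (cornerSubalgebra p C hp hpC) r).2.2⟩ =
          r • 1 := by
        rw [← hΦ, ← map_smul]
        refine congrArg Φ (Subtype.ext ?_)
        change p * algebraMap ℂ A r = r • p
        rw [← Algebra.commutes, ← Algebra.smul_def]
      rw [this, Algebra.algebraMap_eq_smul_one]
      ext a b
      by_cases hab : a = b <;> simp [hab]
    map_star' := fun d => by
      have : Φ ⟨p * ((star d : cornerSubalgebra p C hp hpC) : A), (star d).2.2⟩ =
          star (Φ ⟨p * d, d.2.2⟩) := by
        rw [← map_star]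
        refine congrArg Φ (Subtype.ext ?_)
        change p * star (d : A) = star (p * d)
        rw [d.2.1, star_mul, hp.isSelfAdjoint.star_eq]
      rw [this]
      ext a b
      simp [Matrix.star_apply] }

end Corner

/-! ### The two corners of the approximant -/

section CornerApproximation

variable {A : Type*} [CStarAlgebra A]

/-- `b` is a unit on `q`, so each `x j * q` is a partial isometry with initial projection `q`;
composing with the equivalence `w` from `f` to `q` gives the copies. -/
lemma MurrayVonNeumannEquiv.exists_copies {m : ℕ} {x : Fin m → A} {b e f q : A}
    (h1 : ∀ j, star (x j) * x j = b) (h2 : ∀ j k, j ≠ k → star (x j) * x k = 0) (hbe : b * e = e)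
    (hf : f * f = f) (hq : IsStarProjection q)
    (hqe : q ∈ closure (Set.range fun y : A => e * y * e)) (hfq : MurrayVonNeumannEquiv f q) :
    ∃ v : Fin m → A, (∀ j, star (v j) * v j = f) ∧ ∀ j k, j ≠ k → star (v j) * v k = 0 := by
  obtain ⟨w, hw, hw'⟩ := hfq
  have hbq : b * q = q := by
    have hcl : IsClosed {z : A | b * z = z} := isClosed_eq (by fun_prop) (by fun_prop)
    refine hcl.closure_subset_iff.mpr ?_ hqe
    rintro _ ⟨y, rfl⟩
    change b * (e * y * e) = e * y * e
    rw [← mul_assoc, ← mul_assoc, hbe]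
  have hqs : star q = q := hq.isSelfAdjoint.star_eq
  have hqw : star w * q * w = f := by
    rw [← hw']
    calc star w * (w * star w) * w = (star w * w) * (star w * w) := by simp only [mul_assoc]
      _ = f := by rw [hw, hf]
  refine ⟨fun j => x j * q * w, fun j => ?_, fun j k hjk => ?_⟩
  · calc star (x j * q * w) * (x j * q * w) = star w * (q * ((star (x j) * x j) * q)) * w := by
          simp only [star_mul, hqs, mul_assoc]
      _ = f := by rw [h1, hbq, hq.isIdempotentElem.eq, hqw]
  · calc star (x j * q * w) * (x k * q * w) = star w * (q * ((star (x j) * x k) * q)) * w := by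
          simp only [star_mul, hqs, mul_assoc]
      _ = 0 := by rw [h2 j k hjk]; simp

/-- If the traces of `k g` and `T` differ by integer multiples of `2π` in every representation, then
the corner of `g` is small modulo `logCU`. -/
lemma exists_norm_le_of_cornerEval {p : A} {C : NonUnitalStarSubalgebra ℂ A}
    {hp : IsStarProjection p} {hpC : p ∈ C} (hC : IsClosed (C : Set A))
    (hunit : ∀ c ∈ C, p * c = c ∧ c * p = c) {l : ℕ} {n : Fin l → ℕ} {X : Fin l → Type*}
    [∀ i, TopologicalSpace (X i)]
    (Φ : C ≃⋆ₐ[ℂ] ((i : Fin l) → Matrix (Fin (n i)) (Fin (n i)) C(X i, ℂ))) (hn : ∀ i, 0 < n i)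
    {m : ℕ} (hm : 0 < m) (hmn : ∀ i, X i → m ≤ n i) {k : ℕ} (hk : 0 < k) {g T : A}
    (hg : g ∈ cornerSubalgebra p C hp hpC) (hT : T ∈ cornerSubalgebra p C hp hpC)
    (hTsa : IsSelfAdjoint T)
    (hint : ∀ i x, ∃ M : ℤ, (k : ℂ) * (cornerEval Φ hunit i x ⟨g, hg⟩).trace =
      (cornerEval Φ hunit i x ⟨T, hT⟩).trace + M * (2 * Real.pi)) :
    ∃ a, p * g - a ∈ logCU A ∧ ‖a‖ ≤ ‖T‖ + 2 * Real.pi / m := by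
  let Ψ : (∀ i, Matrix (Fin (n i)) (Fin (n i)) C(X i, ℂ)) →⋆ₙₐ[ℂ] A :=
    { toFun := fun y => (Φ.symm y : A)
      map_smul' := fun c y => by rw [map_smul]; rfl
      map_zero' := by rw [map_zero]; rfl
      map_add' := fun y z => by rw [map_add]; rfl
      map_mul' := fun y z => by rw [map_mul]; rfl
      map_star' := fun y => by rw [map_star]; rfl }
  let G := Φ ⟨p * g, hg.2⟩
  let τ : ∀ i, C(X i, ℂ) := fun i => (Φ ⟨p * T, hT.2⟩ i).trace
  have hΨG : Ψ G = p * g := by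
    change ((Φ.symm (Φ _) : C) : A) = _
    rw [StarAlgEquiv.symm_apply_apply]
  have heval : ∀ (d : A) (hd : d ∈ cornerSubalgebra p C hp hpC) i x,
      (cornerEval Φ hunit i x ⟨d, hd⟩).trace = (Φ ⟨p * d, hd.2⟩ i).trace x := by
    intro d hd i x
    simp only [Matrix.trace, ContinuousMap.sum_apply]
    rfl
  have hτre : ∀ i x, ((τ i x).re : ℂ) = τ i x := by
    intro i x
    rw [← Complex.conj_eq_iff_re]
    change star (τ i x) = τ i x
    rw [← heval T hT, ← Matrix.trace_conjTranspose]
    change (star _ : Matrix _ _ ℂ).trace = _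
    rw [← map_star]
    congr 2
    exact Subtype.ext hTsa
  have hτnorm : ∀ i x, |(τ i x).re| ≤ n i * ‖T‖ := by
    intro i x
    have := isClosed_cornerSubalgebra (hp := hp) (hpC := hpC) hC
    refine (Complex.abs_re_le_norm _).trans ?_
    rw [← heval T hT]
    refine (norm_sum_le _ _).trans ((Finset.sum_le_sum (g := fun _ => ‖T‖) fun a _ => ?_).trans ?_)
    · open scoped Matrix.Norms.L2Operator in
      exact (Matrix.norm_entry_le_l2_opNorm _ a a).trans
        (NonUnitalStarAlgHom.norm_apply_le (cornerEval Φ hunit i x) _)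
    · simp
  choose M hM using hint
  have hk0 : (k : ℝ) ≠ 0 := by positivity
  -- The integers are chosen pointwise, but the trace identity expresses them through continuous
  -- functions.
  have hMcont : ∀ i, Continuous (M i) := by
    intro i
    rw [Int.isClosedEmbedding_coe_real.isEmbedding.continuous_iff]
    have : (fun z : ℤ => (z : ℝ)) ∘ M i =
        fun x => ((k : ℂ) * (G i).trace x - τ i x).re / (2 * Real.pi) := by
      funext x
      have h := hM i x
      rw [heval, heval] at h
      rw [Function.comp_apply, eq_div_iff (by positivity)]
      have h' : (k : ℂ) * (G i).trace x - τ i x = ((M i x * (2 * Real.pi) : ℝ) : ℂ) := by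
        rw [sub_eq_iff_eq_add', h]
        push_cast
        rfl
      rw [h', Complex.ofReal_re]
    rw [this]
    fun_prop
  -- Euclidean division by `k`: the quotient is the integral part of the trace, the remainder goes
  -- into the error `s` and costs at most `2π` whatever the size of `M`.
  let q : ∀ i, C(X i, ℤ) := fun i => ⟨fun x => M i x / k,
    (continuous_of_discreteTopology (f := fun z : ℤ => z / (k : ℤ))).comp (hMcont i)⟩
  have hrcont : ∀ i, Continuous fun x => (((M i x % k : ℤ)) : ℝ) := fun i =>
    (continuous_of_discreteTopology (f := fun z : ℤ => ((z % (k : ℤ) : ℤ) : ℝ))).comp (hMcont i)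
  let s : ∀ i, C(X i, ℝ) := fun i => ⟨fun x => (τ i x).re / k +
    2 * Real.pi * ((M i x % k : ℤ) : ℝ) / k, by have := hrcont i; fun_prop⟩
  have hpi := Real.pi_pos
  have := exists_norm_le_of_trace_eq Ψ hn G q s (η := ‖T‖ + 2 * Real.pi / m) ?_ (by positivity) ?_
  · rwa [hΨG] at this
  · intro i x
    have h := hM i x
    rw [heval, heval] at h
    have hkC : (k : ℂ) ≠ 0 := by exact_mod_cast hk.ne'
    apply mul_left_cancel₀ hkC
    refine h.trans ?_
    have hdm : ((M i x : ℤ) : ℂ) = k * ((M i x / k : ℤ) : ℂ) + ((M i x % k : ℤ) : ℂ) := by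
      have := Int.mul_ediv_add_emod (M i x) k
      exact_mod_cast this.symm
    simp only [q, s, ContinuousMap.coe_mk]
    push_cast
    rw [hτre, hdm]
    change τ i x + _ = _
    field_simp
    ring
  · intro i x
    have hmn' : (m : ℝ) ≤ n i := by exact_mod_cast hmn i x
    have hm' : (0 : ℝ) < m := by exact_mod_cast hm
    have hk' : (1 : ℝ) ≤ k := by exact_mod_cast hk
    have hr0 : (0 : ℝ) ≤ ((M i x % k : ℤ) : ℝ) := by
      exact_mod_cast Int.emod_nonneg _ (by omega)
    have hr1 : ((M i x % k : ℤ) : ℝ) ≤ k := by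
      have := (Int.emod_lt_of_pos (M i x) (b := (k : ℤ)) (by omega)).le
      exact_mod_cast this
    simp only [s, ContinuousMap.coe_mk]
    refine (abs_add_le _ _).trans ?_
    rw [add_mul]
    refine add_le_add ?_ ?_
    · rw [abs_div, abs_of_nonneg (by positivity : (0 : ℝ) ≤ k)]
      refine (div_le_self (abs_nonneg _) hk').trans ?_
      rw [mul_comm]
      exact hτnorm i x
    · rw [abs_of_nonneg (by positivity)]
      calc 2 * Real.pi * ((M i x % k : ℤ) : ℝ) / k ≤ 2 * Real.pi := by
            rw [div_le_iff₀ (by positivity)]; gcongr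
        _ ≤ 2 * Real.pi / m * n i := by
            rw [div_mul_eq_mul_div, le_div_iff₀ hm']; gcongr

end CornerApproximation

/-! ### Tracial rank and the conclusion -/

section TracialRank

variable {A : Type*} [CStarAlgebra A] [PartialOrder A] [StarOrderedRing A]

lemma TracialRankLEOne.exists_cornerSubalgebra_mem (hTR : TracialRankLEOne A) {e : A}
    (he : 0 ≤ e) (he0 : e ≠ 0) {S : Set (StarSubalgebra ℂ A)} (hS : S ∈ approxFilter A) :
    ∃ (p : A) (C : NonUnitalStarSubalgebra ℂ A) (hp : IsStarProjection p) (hpC : p ∈ C),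
      cornerSubalgebra p C hp hpC ∈ S ∧ IsMatrixBlockSubalgebraDimLEOne C ∧
      (∀ c ∈ C, p * c = c ∧ c * p = c) ∧
      ∃ q : A, IsStarProjection q ∧ q ∈ closure (Set.range fun x : A => e * x * e) ∧
        MurrayVonNeumannEquiv (1 - p) q := by
  classical
  obtain ⟨F, ε, hε, hF⟩ := hS
  obtain ⟨p, C, hp, -, hC, hpC, hunit, hcomm, happ, hq⟩ :=
    hTR (ε / 3) (by positivity) (insert e F) e (Finset.mem_insert_self _ _) he he0
  refine ⟨p, C, hp, hpC, hF _ (isClosed_cornerSubalgebra hC.1) fun x hx => ?_, hC, hunit, hq⟩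
  have h1 := hcomm x (Finset.mem_insert_of_mem hx)
  obtain ⟨c, hc, hxc⟩ := happ x (Finset.mem_insert_of_mem hx)
  have hpp : p * p = p := hp.isIdempotentElem.eq
  -- The two off-diagonal corners of `x` are controlled by `[p, x]`, so the error consists of three
  -- terms below `ε/3`.
  refine ⟨c + (1 - p) * x * (1 - p), ?_, ?_⟩
  · have hl : p * (c + (1 - p) * x * (1 - p)) = c := by
      calc p * (c + (1 - p) * x * (1 - p)) = p * c + (p - p * p) * x * (1 - p) := by noncomm_ring
        _ = c := by rw [hpp, sub_self, (hunit c hc).1]; simp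
    have hr : (c + (1 - p) * x * (1 - p)) * p = c := by
      calc (c + (1 - p) * x * (1 - p)) * p = c * p + (1 - p) * x * (p - p * p) := by noncomm_ring
        _ = c := by rw [hpp, sub_self, (hunit c hc).2]; simp
    exact mem_cornerSubalgebra.mpr ⟨hl.trans hr.symm, by rwa [hl]⟩
  · have hdecomp : x - (c + (1 - p) * x * (1 - p)) =
        (p * x * p - c) + ((p * x - x * p) * (1 - p) - (1 - p) * (p * x - x * p)) := by
      have : (p * x - x * p) * (1 - p) - (1 - p) * (p * x - x * p) =
          p * x + x * p - p * x * p - p * x * p - x * (p - p * p) - (p - p * p) * x := by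
        noncomm_ring
      rw [this, hpp]
      noncomm_ring
    have hn : ‖1 - p‖ ≤ 1 := hp.one_sub.norm_le
    have hr : ‖(p * x - x * p) * (1 - p)‖ ≤ ‖p * x - x * p‖ := by
      refine (norm_mul_le _ _).trans ?_
      exact mul_le_of_le_one_right (norm_nonneg _) hn
    have hl : ‖(1 - p) * (p * x - x * p)‖ ≤ ‖p * x - x * p‖ := by
      refine (norm_mul_le _ _).trans ?_
      exact mul_le_of_le_one_left (norm_nonneg _) hn
    rw [hdecomp]
    have h2 := norm_add_le (p * x * p - c)
      ((p * x - x * p) * (1 - p) - (1 - p) * (p * x - x * p))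
    have h3 := norm_sub_le ((p * x - x * p) * (1 - p)) ((1 - p) * (p * x - x * p))
    linarith

lemma expUnitary_mem_CU_of_nsmul (hsimple : IsSimpleCStarAlgebra A) (hinf : ¬ FiniteDimensional ℂ A)
    (hTR : TracialRankLEOne A) {h : selfAdjoint A} {k : ℕ} (hk : 0 < k)
    (hkh : expUnitary (k • h) ∈ CU A) : expUnitary h ∈ CU A := by
  rw [← coe_mem_logCU]
  suffices hcl : (h : A) ∈ closure (logCU A : Set A) by
    rwa [isClosed_logCU.closure_eq] at hcl
  rw [Metric.mem_closure_iff]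
  intro η hη
  -- Four errors of `η/4`: `h - g`, the averaged complement `(‖h‖ + 1)/m`, `‖T‖`, and the remainder
  -- term `2π/m`.
  obtain ⟨m, hm⟩ := exists_nat_gt (max ((‖(h : A)‖ + 1) / (η / 4)) (2 * Real.pi / (η / 4)))
  have hpi := Real.pi_pos
  have hm' : (0 : ℝ) < m := lt_of_le_of_lt (by positivity) hm
  have hm0 : 0 < m := by exact_mod_cast hm'
  have hm1 : (‖(h : A)‖ + 1) / m < η / 4 := by
    rw [div_lt_comm₀ hm' (by positivity)]
    exact (le_max_left _ _).trans_lt hm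
  have hm2 : 2 * Real.pi / m < η / 4 := by
    rw [div_lt_comm₀ hm' (by positivity)]
    exact (le_max_right _ _).trans_lt hm
  obtain ⟨x, b, e, h1, h2, he, he0, hbe⟩ := exists_orthogonal_copies hsimple hinf m
  have hb : b ≠ 0 := by
    rintro rfl
    exact he0 (by rw [← hbe, zero_mul])
  have hδ : 0 < min 1 (η / 4) := by positivity
  obtain ⟨p, C, hp, hpC, ⟨hlarge, g, T, hg, hT, hhg, hTδ, v, hv, hgT⟩, hC, hunit, q, hq, hqe, hpq⟩ :=
    hTR.exists_cornerSubalgebra_mem he he0 ((eventually_le_of_starAlgHom hsimple hb h1 h2).and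
      (eventually_exists_expUnitary_eq hkh hδ))
  obtain ⟨hCc, l, n, X, _, hn, -, -, ⟨Φ⟩⟩ := hC
  obtain ⟨w, hw1, hw2⟩ :=
    hpq.exists_copies h1 h2 hbe hp.one_sub.isIdempotentElem.eq hq hqe
  obtain ⟨a, ha, hanorm⟩ := exists_norm_le_of_cornerEval hCc hunit Φ hn hm0
    -- A block is known to be large only through an evaluation, so the bound is claimed only when `X
    -- i` has a point `y`.
    (fun i y => hlarge _ (hn i) (cornerEval Φ hunit i y)) hk hg hT T.2
    (fun i y => exists_int_trace_eq (isClosed_cornerSubalgebra hCc) _ hg hT hv hgT)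
  have hpg : (1 - p) * (g : A) = g * (1 - p) := by
    rw [sub_mul, mul_sub, one_mul, mul_one, hg.1]
  obtain ⟨s, hs, hsnorm⟩ := exists_norm_le_of_copies hm0 hp.one_sub.isIdempotentElem.eq hw1 hw2
    (y := (1 - p) * (g : A)) (by
      rw [IsSelfAdjoint, star_mul, hp.one_sub.isSelfAdjoint.star_eq, g.2.star_eq, hpg])
    (by rw [← mul_assoc, hp.one_sub.isIdempotentElem.eq])
  refine ⟨((1 - p) * (g : A) - s) + (p * g - a), add_mem hs ha, ?_⟩
  have hgn : ‖(1 - p) * (g : A)‖ ≤ ‖(h : A)‖ + 1 := by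
    refine (norm_mul_le _ _).trans
      ((mul_le_of_le_one_left (norm_nonneg _) hp.one_sub.norm_le).trans ?_)
    have := norm_le_norm_add_norm_sub (h : A) (g : A)
    linarith [min_le_left 1 (η / 4)]
  have hsn : ‖s‖ < η / 4 :=
    (hsnorm.trans (by gcongr)).trans_lt hm1
  have hδ' := min_le_right 1 (η / 4)
  rw [dist_eq_norm]
  have : (h : A) - (((1 - p) * (g : A) - s) + (p * g - a)) = (h - g) + (s + a) := by
    noncomm_ring
  rw [this]
  have h3 := norm_add_le ((h : A) - g) (s + a)
  have h4 := norm_add_le s a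
  linarith

lemma mem_CU_of_pow_mem_CU (hsimple : IsSimpleCStarAlgebra A) (hinf : ¬ FiniteDimensional ℂ A)
    (hTR : TracialRankLEOne A) {u : unitary A} (hu : u ∈ U₀ A) {k : ℕ} (hk : 0 < k)
    (huk : u ^ k ∈ CU A) : u ∈ CU A := by
  obtain ⟨h, hh⟩ := exists_mk_expUnitary_eq hu
  rw [← QuotientGroup.eq_one_iff, ← hh, QuotientGroup.eq_one_iff]
  refine expUnitary_mem_CU_of_nsmul hsimple hinf hTR hk ?_
  rw [expUnitary_nsmul, ← QuotientGroup.eq_one_iff, QuotientGroup.mk_pow, hh,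
    ← QuotientGroup.mk_pow, QuotientGroup.eq_one_iff]
  exact huk

end TracialRank

end TorsionFree

theorem theorem6p11 (A : Type*) [CStarAlgebra A] [PartialOrder A] [StarOrderedRing A]
    [TopologicalSpace.SeparableSpace A]
    (hsimple : IsSimpleCStarAlgebra A)
    (hinf : ¬ FiniteDimensional ℂ A)
    (hTR : TracialRankLEOne A) :
    (∀ u : unitary A, u ∈ U₀ A → ∀ k : ℕ, 0 < k → u ^ k ∈ CU A → u ∈ CU A) ∧
      (∀ g : U₀ A ⧸ (CU A).subgroupOf (U₀ A), IsOfFinOrder g → g = 1) := by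
  have hmain := fun (u : unitary A) (hu : u ∈ U₀ A) (k : ℕ) (hk : 0 < k) (huk : u ^ k ∈ CU A) =>
    mem_CU_of_pow_mem_CU hsimple hinf hTR hu hk huk
  refine ⟨hmain, fun g hg => ?_⟩
  obtain ⟨u, rfl⟩ := QuotientGroup.mk_surjective g
  obtain ⟨k, hk, hgk⟩ := isOfFinOrder_iff_pow_eq_one.mp hg
  rw [← QuotientGroup.mk_pow, QuotientGroup.eq_one_iff, Subgroup.mem_subgroupOf] at hgk
  rw [QuotientGroup.eq_one_iff, Subgroup.mem_subgroupOf]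
  exact hmain u u.2 k hk (by simpa using hgk)
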